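/- **Notation.** Let $\mathbb B_n=\mathbb F_2[X_1,\dots,X_n]/\langle X_1^2-X_1,\dots,X_n^2-X_n\rangle$ with indeterminates $x_i$, and let $\mathbb L_n=\langle 1,x_1,\dots,x_n\rangle_{\mathbb F_2}$. For $S\subseteq\mathbb B_n$ let $\mathcal Z(S)\subseteq\mathbb F_2^n$ be its set of common zeros. A 2-XNF formula $F$ in $n$ variables is a conjunction of clauses, each a disjunction of at most two linerals, where a lineral is an XOR of literals. $\mathcal S(F)\subseteq\mathbb F_2^n$ is the set of satisfying assignments of $F$, and $I_F\subseteq\mathbb B_n$ is the unique ideal with $\mathcal Z(I_F)=\mathcal S(F)$. An *implication graph structure* (IGS) for $F$ is a tuple $(L,V,E)$ with $L,V\subseteq\mathbb L_n$ and $E\subseteq V^2$ such that $I_F=\langle L\rangle+\langle fg\mid (f+1,g)\in E\rangle$; $(f+1,g)\in E$ implies $(g+1,f)\in E$; and $(f,f)\notin E$ for all $f\in V$. Paths in $(V,E)$ are directed and may consist of one vertex; $f\to g$ means that there is a path from $f$ to $g$; $D_f$ and $A_f$ are the sets of descendants and ancestors of $f$, both including $f$ itself. A source is a vertex without incoming edges.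 Fix a term ordering $\sigma$, with leading terms $\mathrm{LT}_\sigma$ and normal remainders $\mathrm{NR}_\sigma$. **Subroutines.** * $\mathtt{GGCP}_\sigma(L,V,E)$: (i) replace $L$ by a basis of $\langle L\rangle_{\mathbb F_2}$ with pairwise distinct leading terms; (ii) put $L'=L$, $V'=E'=\emptyset$, and for each $(f,g)\in E$ let $f'=\mathrm{NR}_\sigma(f,L)$, $g'=\mathrm{NR}_\sigma(g,L)$; if $f'=0\ne g'$, add $g'$ to $L'$; if $g'=1\neq f'$, add $f'+1$ to $L'$; if $f',g'\notin\mathbb F_2$ and $f'\ne g'$, add $(f',g')$ to $E'$ and $f',g'$ to $V'$; (iii) if $L'\neq L$, start again at (i) with $(L',V',E')$; otherwise return $(L',V',E')$. * $\mathtt{crGGCP}_\sigma(G)$: let $(L',V',E')=\mathtt{GGCP}_\sigma(G)$. If the number of strongly connected components of $(V',E')$ is odd, return $(\mathbb L_n,\emptyset,\emptyset)$. Otherwise list each component as $\{f_1,\dots,f_r\}$ and let $L_{\mathtt{SCC}}$ be the set of all $f_1+f_i$ with $i\ge2$. If $L_{\mathtt{SCC}}\neq\emptyset$, start again with $(L'\cup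 L_{\mathtt{SCC}},V',E')$; otherwise return $(L',V',E')$. * $\mathtt{tFLS}(L,V,E)$: let $M$ consist of the pairs $(s,s+1)$ with $s$ a source and $s+1\in D_s$, and of the pairs $(s,g)$ with $s$ a source, $g\in V$, $s\to g$ and $s\to g+1$. Return $\bigcup_{(s,g)\in M}(A_g\cap A_{g+1})$. A *decision* for $(L,V,E)$ with ideal $I=\langle L\rangle+\langle fg\mid(f+1,g)\in E\rangle$ is a pair $(L_0,L_1)$ of subsets of $\mathbb L_n$ with $L_0,L_1\not\subseteq\langle L\rangle_{\mathbb F_2}$ and $\mathcal Z(I)\subseteq\mathcal Z(I+\langle L_0\rangle)\cup\mathcal Z(I+\langle L_1\rangle)$. **The solver** $\mathtt{G\_2XNF\_DPLL}_\sigma(L,V,E)$: 1. Let $(L,V,E)=\mathtt{crGGCP}_\sigma(L,V,E)$. 2. Let $L_{\mathtt{FL}}=\mathtt{tFLS}(L,V,E)$ and adjoin $\{f+1\mid f\in L_{\mathtt{FL}}\}$ to $L$. 3. If $L_{\mathtt{FL}}\ne\emptyset$, go to 1. 4. If $1\in\langle L\rangle_{\mathbb F_2}$, return $\mathtt{UNSAT}$.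 5. If $E=\emptyset$, return some $a\in\mathcal Z(L)$. 6. Select one of the following methods and use it to obtain a pair $(L_0,L_1)$: * *MaxReach*: $(D_f,\{f+1\})$ for a source $f$ with the maximal number of paths starting at it; * *MaxBottleneck*: $(D_f,D_{f+1})$ for a vertex $f$ such that the number of paths ending in $f$ plus the number of paths starting at $f$ is maximal; * *MaxPath*: $(\{f_1+f_i\mid 1\le i\le r\},\{f_1+1,f_r\})$ for a longest path $f_1\to\dots\to f_r$; * any other choice of a decision $(L_0,L_1)$ for $(L,V,E)$. 7. If $\mathtt{G\_2XNF\_DPLL}_\sigma(L\cup L_0,V,E)$ returns some $a\in\mathbb F_2^n$, return $a$. 8. Otherwise return the result of $\mathtt{G\_2XNF\_DPLL}_\sigma(L\cup L_1,V,E)$. All choices left open (bases, listings of components, zeros, methods, vertices, paths, decisions) may be made arbitrarily. **Proposition.** Let $F$ be a formula in 2-XNF with an implication graph structure $(L,V,E)$, and let $\sigma$ be a term ordering. Then every run of $\mathtt{G\_2XNF\_DPLL}_\sigma$ on input $(L,V,E)$ can always be continued until it returns a result, and it does so after finitely many steps. The result is $\mathtt{UNSAT}$ if and only if $\mathcal S(F)=\emptyset$;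 otherwise it is an element $a\in\mathcal S(F)$. -/

import Mathlib

namespace TwoXNF

/-! ### Boolean polynomials and linear Boolean polynomials -/

/-- The ring of Boolean polynomials `𝔹ₙ = 𝔽₂[X₁,…,Xₙ] / ⟨X₁² - X₁, …, Xₙ² - Xₙ⟩`. -/
abbrev BoolRing (n : ℕ) : Type :=
  MvPolynomial (Fin n) (ZMod 2) ⧸
    Ideal.span (Set.range fun i : Fin n =>
      (MvPolynomial.X i ^ 2 - MvPolynomial.X i : MvPolynomial (Fin n) (ZMod 2)))

/-- The indeterminate `xᵢ` of `𝔹ₙ`. -/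
noncomputable def x {n : ℕ} (i : Fin n) : BoolRing n :=
  Ideal.Quotient.mk _ (MvPolynomial.X i)

/-- Evaluation of Boolean polynomials at a point `a ∈ 𝔽₂ⁿ`. -/
noncomputable def evalAt {n : ℕ} (a : Fin n → ZMod 2) : BoolRing n →+* ZMod 2 :=
  Ideal.Quotient.lift _ (MvPolynomial.eval a) (by
    intro p hp
    have hle : Ideal.span (Set.range fun i : Fin n =>
        (MvPolynomial.X i ^ 2 - MvPolynomial.X i : MvPolynomial (Fin n) (ZMod 2)))
        ≤ RingHom.ker (MvPolynomial.eval a) := by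
      rw [Ideal.span_le]
      rintro _ ⟨i, rfl⟩
      have h2 : ∀ c : ZMod 2, c ^ 2 - c = 0 := by decide
      simp only [SetLike.mem_coe, RingHom.mem_ker, map_sub, map_pow, MvPolynomial.eval_X]
      exact h2 (a i)
    exact hle hp)

/-- The zero set `𝒵(S) ⊆ 𝔽₂ⁿ` of a set `S` of Boolean polynomials. -/
def zeroSet {n : ℕ} (S : Set (BoolRing n)) : Set (Fin n → ZMod 2) :=
  {a | ∀ f ∈ S, evalAt a f = 0}

/-- The terms of degree at most one: `none` is `1`, and `some i` is `xᵢ`. -/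
abbrev LinTerm (n : ℕ) : Type := Option (Fin n)

/-- The term as a Boolean polynomial. -/
noncomputable def LinTerm.toBool {n : ℕ} : LinTerm n → BoolRing n
  | none => 1
  | some i => x i

/-- The exponent vector of the term. -/
noncomputable def LinTerm.exponent {n : ℕ} : LinTerm n → (Fin n →₀ ℕ)
  | none => 0
  | some i => Finsupp.single i 1

/-- The space `𝕃ₙ = 𝔽₂ ⊕ 𝔽₂ x₁ ⊕ ⋯ ⊕ 𝔽₂ xₙ` of linear Boolean polynomials, given by the
coefficients with respect to the basis `1, x₁, …, xₙ`. -/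
def Lin (n : ℕ) : Type := LinTerm n → ZMod 2

instance (n : ℕ) : AddCommGroup (Lin n) := inferInstanceAs (AddCommGroup (LinTerm n → ZMod 2))

instance (n : ℕ) : Module (ZMod 2) (Lin n) :=
  inferInstanceAs (Module (ZMod 2) (LinTerm n → ZMod 2))

instance (n : ℕ) : Finite (Lin n) := inferInstanceAs (Finite (LinTerm n → ZMod 2))

/-- The constant polynomial `1`. -/
instance (n : ℕ) : One (Lin n) := ⟨fun t => if t = none then 1 else 0⟩

/-- The inclusion `𝕃ₙ ⊆ 𝔹ₙ`. -/
noncomputable def Lin.toBool {n : ℕ} : Lin n →ₗ[ZMod 2] BoolRing n where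
  toFun f := ∑ t : LinTerm n, f t • LinTerm.toBool t
  map_add' f g := by
    rw [← Finset.sum_add_distrib]
    exact Finset.sum_congr rfl fun t _ => add_smul (f t) (g t) _
  map_smul' c f := by
    rw [Finset.smul_sum]
    exact Finset.sum_congr rfl fun t _ => mul_smul c (f t) _

/-- The set of common zeros of a set of linear Boolean polynomials. -/
def linZeroSet {n : ℕ} (L : Set (Lin n)) : Set (Fin n → ZMod 2) := zeroSet (Lin.toBool '' L)

/-- The ideal `⟨L⟩ ⊆ 𝔹ₙ` generated by a set of linear Boolean polynomials. -/
noncomputable def linIdeal {n : ℕ} (L : Set (Lin n)) : Ideal (BoolRing n) :=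
  Ideal.span (Lin.toBool '' L)

/-- The support of a linear Boolean polynomial. -/
def Lin.supp {n : ℕ} (f : Lin n) : Set (LinTerm n) := {t | f t ≠ 0}

/-! ### Formulas in XNF -/

/-- A literal: a variable or its negation. -/
structure Literal (n : ℕ) where
  var : Fin n
  negated : Bool

/-- The truth value of a literal under an assignment (`True` is `1` and `False` is `0`). -/
def Literal.value {n : ℕ} (l : Literal n) (a : Fin n → ZMod 2) : ZMod 2 :=
  if l.negated then 1 + a l.var else a l.var

/-- A lineral `L₁ ⊕ ⋯ ⊕ Lₘ`: an XOR of literals. -/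
abbrev Lineral (n : ℕ) : Type := List (Literal n)

/-- The truth value of a lineral. -/
def Lineral.value {n : ℕ} (l : Lineral n) (a : Fin n → ZMod 2) : ZMod 2 :=
  (l.map fun lit => lit.value a).sum

/-- An XNF clause: a disjunction of linerals. -/
abbrev XNFClause (n : ℕ) : Type := List (Lineral n)

/-- A formula in XNF: a conjunction of XNF clauses. -/
abbrev XNF (n : ℕ) : Type := List (XNFClause n)

/-- The formula is in `k`-XNF: every clause involves at most `k` linerals. -/
def XNF.IsKXNF {n : ℕ} (F : XNF n) (k : ℕ) : Prop := ∀ C ∈ F, C.length ≤ k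

/-- The set `𝒮(F)` of satisfying assignments. -/
def XNF.sat {n : ℕ} (F : XNF n) : Set (Fin n → ZMod 2) :=
  {a | ∀ C ∈ F, ∃ l ∈ C, Lineral.value l a = 1}

/-- The algebraic representation `I_F ⊆ 𝔹ₙ` of `F`, i.e. the unique ideal with
`𝒵(I_F) = 𝒮(F)`: the ideal of all Boolean polynomials vanishing on `𝒮(F)`
(see `zeroSet_eq_sat_iff`). -/
noncomputable def XNF.algRep {n : ℕ} (F : XNF n) : Ideal (BoolRing n) where
  carrier := {f | ∀ a ∈ F.sat, evalAt a f = 0}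
  add_mem' hf hg := fun a ha => by rw [map_add, hf a ha, hg a ha, add_zero]
  zero_mem' := fun a _ => map_zero _
  smul_mem' c f hf := fun a ha => by rw [smul_eq_mul, map_mul, hf a ha, mul_zero]

theorem evalAt_x {n : ℕ} (a : Fin n → ZMod 2) (i : Fin n) : evalAt a (x i) = a i :=
  (Ideal.Quotient.lift_mk _ _ _).trans (MvPolynomial.eval_X i)

/-- Evaluation of a linear Boolean polynomial at a point. -/
theorem evalAt_toBool {n : ℕ} (f : Lin n) (a : Fin n → ZMod 2) :
    evalAt a f.toBool = f none + ∑ i, f (some i) * a i := by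
  have hs : ∀ (c : ZMod 2) (p : BoolRing n), evalAt a (c • p) = c * evalAt a p := by
    intro c p
    have h4 : ∀ c : ZMod 2, c = 1 ∨ c = 0 := by decide
    rcases h4 c with rfl | rfl <;> simp
  simp [Lin.toBool, map_sum, hs, Fintype.sum_option, LinTerm.toBool, evalAt_x]

/-- The map `𝕃ₙ → 𝔹ₙ` is an inclusion. -/
theorem Lin.toBool_injective {n : ℕ} : Function.Injective (Lin.toBool (n := n)) := by
  classical
  intro f g h
  have h1 := fun a => congrArg (evalAt a) h
  simp only [evalAt_toBool] at h1
  have h0 : f none = g none := by simpa using h1 0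
  funext t
  cases t with
  | none => exact h0
  | some i =>
    have := h1 (Pi.single i 1)
    simpa [h0, Pi.single_apply] using this

/-- Boolean polynomials are determined by their values. -/
theorem eq_of_evalAt_eq {n : ℕ} {f g : BoolRing n} (h : ∀ a, evalAt a f = evalAt a g) :
    f = g := by
  obtain ⟨p, rfl⟩ := Ideal.Quotient.mk_surjective f
  obtain ⟨q, rfl⟩ := Ideal.Quotient.mk_surjective g
  have h0 : ∀ a : Fin n → ZMod 2, MvPolynomial.eval a (p - q) = 0 := by
    intro a
    have ha : MvPolynomial.eval a p = MvPolynomial.eval a q := h a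
    rw [map_sub, ha, sub_self]
  obtain ⟨c, -, hc⟩ := MvPolynomial.combinatorial_nullstellensatz_exists_linearCombination
    (fun _ : Fin n => (Finset.univ : Finset (ZMod 2))) (fun _ => Finset.univ_nonempty)
    (p - q) (fun a _ => h0 a)
  rw [Ideal.Quotient.eq, hc, Finsupp.linearCombination_apply]
  refine Ideal.sum_mem _ fun i _ => Ideal.mul_mem_left _ _ (Ideal.subset_span ⟨i, ?_⟩)
  have hu : (Finset.univ : Finset (ZMod 2)) = {0, 1} := by decide
  rw [hu, Finset.prod_pair (by decide)]
  simp only [map_zero, map_one]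
  ring

/-- The algebraic representation `I_F` is the unique ideal with zero set `𝒮(F)`. -/
theorem zeroSet_eq_sat_iff {n : ℕ} (F : XNF n) (I : Ideal (BoolRing n)) :
    zeroSet (I : Set (BoolRing n)) = F.sat ↔ I = F.algRep := by
  classical
  constructor
  · intro h
    refine le_antisymm (fun f hf a ha => ?_) fun f hf => ?_
    · rw [← h] at ha
      exact ha f hf
    · have hex : ∀ a : Fin n → ZMod 2, ∃ g ∈ I, a ∉ F.sat → evalAt a g = 1 := by
        intro a
        by_cases ha : a ∈ F.sat
        · exact ⟨0, I.zero_mem, fun h' => absurd ha h'⟩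
        · rw [← h] at ha
          simp only [zeroSet, Set.mem_ofPred_eq, not_forall] at ha
          obtain ⟨g, hg, hga⟩ := ha
          have h2 : ∀ c : ZMod 2, c ≠ 0 → c = 1 := by decide
          exact ⟨g, hg, fun _ => h2 _ hga⟩
      choose g hgI hg using hex
      have hprod : ∀ s : Finset (Fin n → ZMod 2), 1 - ∏ a ∈ s, (1 - g a) ∈ I := by
        intro s
        induction s using Finset.induction_on with
        | empty => simp
        | insert a s ha ih =>
          rw [Finset.prod_insert ha]
          have : 1 - (1 - g a) * ∏ b ∈ s, (1 - g b)
              = (1 - ∏ b ∈ s, (1 - g b)) + (∏ b ∈ s, (1 - g b)) * g a := by ring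
          rw [this]
          exact I.add_mem ih (I.mul_mem_left _ (hgI a))
      have hfe : f = f * (1 - ∏ a, (1 - g a)) := by
        refine eq_of_evalAt_eq fun a => ?_
        by_cases ha : a ∈ F.sat
        · rw [map_mul, hf a ha, zero_mul]
        · rw [map_mul, map_sub, map_prod, Finset.prod_eq_zero (Finset.mem_univ a), map_one,
            sub_zero, mul_one]
          rw [map_sub, map_one, hg a ha, sub_self]
      rw [hfe]
      exact I.mul_mem_left _ (hprod _)
  · rintro rfl
    refine Set.Subset.antisymm (fun a ha => ?_) fun a ha f hf => hf a ha
    by_contra hna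
    have h2 : ∀ b c : ZMod 2, b ≠ c → 1 + b + c = 0 := by decide
    have h3 : ∀ b : ZMod 2, 1 + b + b = 1 := by decide
    have hv : ∀ b : Fin n → ZMod 2,
        evalAt b (∏ i, (1 + x i + (if a i = 1 then 1 else 0) : BoolRing n))
          = ∏ i, (1 + b i + a i) := by
      intro b
      rw [map_prod]
      refine Finset.prod_congr rfl fun i _ => ?_
      have h4 : ∀ c : ZMod 2, c = 1 ∨ c = 0 := by decide
      rcases h4 (a i) with hi | hi <;> simp [hi, evalAt_x]
    have := ha (∏ i, (1 + x i + (if a i = 1 then 1 else 0) : BoolRing n)) (by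
      intro b hb
      have hab : b ≠ a := fun hab => hna (hab ▸ hb)
      obtain ⟨i, hi⟩ := Function.ne_iff.mp hab
      rw [hv]
      exact Finset.prod_eq_zero (Finset.mem_univ i) (h2 _ _ hi))
    rw [hv] at this
    simp [h3] at this

/-! ### Implication graph structures -/

/-- A tuple `(L, V, E)` with `L, V ⊆ 𝕃ₙ` and a set `E` of pairs. -/
structure Tuple (n : ℕ) where
  L : Set (Lin n)
  V : Set (Lin n)
  E : Set (Lin n × Lin n)

/-- The ideal `⟨L⟩ + ⟨f g ∣ (f + 1, g) ∈ E⟩`. -/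
noncomputable def Tuple.ideal {n : ℕ} (G : Tuple n) : Ideal (BoolRing n) :=
  linIdeal G.L ⊔
    Ideal.span {p | ∃ f g : Lin n, (f + 1, g) ∈ G.E ∧ p = f.toBool * g.toBool}

/-- `G` is an implication graph structure (IGS) for `F`. -/
structure IsIGS {n : ℕ} (F : XNF n) (G : Tuple n) : Prop where
  edge_mem : ∀ e ∈ G.E, e.1 ∈ G.V ∧ e.2 ∈ G.V
  algRep_eq : F.algRep = G.ideal
  skew : ∀ f g : Lin n, (f + 1, g) ∈ G.E → (g + 1, f) ∈ G.E
  no_loop : ∀ f ∈ G.V, (f, f) ∉ G.E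

/-- `l` is a path `f₁, …, fₛ` (with `s ≥ 1`) in the graph `(V, E)`. -/
def Tuple.IsPath {n : ℕ} (G : Tuple n) (l : List (Lin n)) : Prop :=
  l ≠ [] ∧ (∀ f ∈ l, f ∈ G.V) ∧ l.IsChain fun f g => (f, g) ∈ G.E

/-- There is a path `f → g`. (One-element paths are paths, so `f → f` for `f ∈ V`.) -/
def Tuple.Reaches {n : ℕ} (G : Tuple n) (f g : Lin n) : Prop :=
  ∃ l, G.IsPath l ∧ l.head? = some f ∧ l.getLast? = some g

/-- The set `D_f` of descendants of `f`. -/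
def Tuple.desc {n : ℕ} (G : Tuple n) (f : Lin n) : Set (Lin n) :=
  {f} ∪ {g | g ∈ G.V ∧ G.Reaches f g}

/-- The set `A_f` of ancestors of `f`. -/
def Tuple.anc {n : ℕ} (G : Tuple n) (f : Lin n) : Set (Lin n) :=
  {f} ∪ {g | g ∈ G.V ∧ G.Reaches g f}

/-- The sources of the graph, i.e. the vertices without incoming edges. -/
def Tuple.sources {n : ℕ} (G : Tuple n) : Set (Lin n) :=
  {f | f ∈ G.V ∧ ∀ g, (g, f) ∉ G.E}

/-- The set of strongly connected components: the maximal nonempty sets of vertices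
any two of which are connected by a path. -/
def Tuple.sccs {n : ℕ} (G : Tuple n) : Set (Set (Lin n)) :=
  {S | Maximal (fun S : Set (Lin n) =>
    S.Nonempty ∧ S ⊆ G.V ∧ ∀ f ∈ S, ∀ g ∈ S, G.Reaches f g) S}

/-! ### Leading terms, interreduction and normal remainders -/

/-- `t` is the leading term of `f` with respect to the term ordering `σ`. -/
def IsLT {n : ℕ} (σ : MonomialOrder (Fin n)) (f : Lin n) (t : LinTerm n) : Prop :=
  t ∈ f.supp ∧ ∀ u ∈ f.supp, σ.toSyn (LinTerm.exponent u) ≤ σ.toSyn (LinTerm.exponent t)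

/-- `L'` is obtained by `LT_σ`-interreducing `L`: it consists of nonzero polynomials with
pairwise distinct leading terms and spans the same vector space. -/
def IsInterreduction {n : ℕ} (σ : MonomialOrder (Fin n)) (L L' : Set (Lin n)) : Prop :=
  Submodule.span (ZMod 2) L' = Submodule.span (ZMod 2) L ∧ (0 : Lin n) ∉ L' ∧
    ∀ f ∈ L', ∀ g ∈ L', ∀ t, IsLT σ f t → IsLT σ g t → f = g

/-- `r` is the normal remainder of `f` under division by `L`: `f - r` lies in the ideal
generated by `L` and no term of `r` is divisible by a leading term of an element of `L`.
It is used only for interreduced `L`, where the remainder exists and is unique. If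
`1 ∈ L`, then it is `0`, as `1` divides all terms. -/
def IsNR {n : ℕ} (σ : MonomialOrder (Fin n)) (L : Set (Lin n)) (f r : Lin n) : Prop :=
  (f - r).toBool ∈ linIdeal L ∧
    ∀ l ∈ L, ∀ t, IsLT σ l t → ∀ u ∈ r.supp, ¬ LinTerm.exponent t ≤ LinTerm.exponent u

/-! ### The subroutines `GGCP`, `crGGCP` and `tFLS` -/

/-- The pairs `(f', g')` of normal remainders of the edges `(f, g)`. -/
def remainderPairs {n : ℕ} (σ : MonomialOrder (Fin n)) (G : Tuple n) : Set (Lin n × Lin n) :=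
  {e | ∃ f g : Lin n, (f, g) ∈ G.E ∧ IsNR σ G.L f e.1 ∧ IsNR σ G.L g e.2}

/-- The edges kept by one pass of `GGCP`: neither end is constant, and they differ. -/
def keptEdges {n : ℕ} (σ : MonomialOrder (Fin n)) (G : Tuple n) : Set (Lin n × Lin n) :=
  {e | e ∈ remainderPairs σ G ∧ e.1 ≠ 0 ∧ e.1 ≠ 1 ∧ e.2 ≠ 0 ∧ e.2 ≠ 1 ∧ e.1 ≠ e.2}

/-- The tuple `(L', V', E')` computed by one pass of `GGCP` through all edges. -/
def ggcpPass {n : ℕ} (σ : MonomialOrder (Fin n)) (G : Tuple n) : Tuple n where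
  L := G.L
    ∪ {h | ∃ e ∈ remainderPairs σ G, e.1 = 0 ∧ e.2 ≠ 0 ∧ h = e.2}
    ∪ {h | ∃ e ∈ remainderPairs σ G, e.2 = 1 ∧ e.1 ≠ 1 ∧ h = e.1 + 1}
  V := {h | ∃ e ∈ keptEdges σ G, h = e.1 ∨ h = e.2}
  E := keptEdges σ G

/-- The set `L_SCC` of all `f₁ + fᵢ` with `i ≥ 2`, for the strongly connected components
`S = {f₁, …, fᵣ}`, where the first element `f₁` of `S` is `first S`. -/
def sccLinerals {n : ℕ} (G : Tuple n) (first : Set (Lin n) → Lin n) : Set (Lin n) :=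
  {h | ∃ S ∈ G.sccs, ∃ f ∈ S, f ≠ first S ∧ h = first S + f}

/-- The set `M` of the trivial failed lineral search. -/
def tFLSPairs {n : ℕ} (G : Tuple n) : Set (Lin n × Lin n) :=
  {p | p.1 ∈ G.sources ∧
    ((p.2 = p.1 + 1 ∧ p.1 + 1 ∈ G.desc p.1) ∨
      (p.2 ∈ G.V ∧ G.Reaches p.1 p.2 ∧ G.Reaches p.1 (p.2 + 1)))}

/-- The output of `tFLS`: the common ancestors of `g` and `g + 1` for all `(s, g) ∈ M`. -/
def tFLS {n : ℕ} (G : Tuple n) : Set (Lin n) :=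
  {f | ∃ p ∈ tFLSPairs G, f ∈ G.anc p.2 ∩ G.anc (p.2 + 1)}

/-! ### Decisions -/

/-- `(L₀, L₁)` is a decision for `G`. Here `G.ideal` is `I_F` if `G` is an IGS for `F`. -/
def IsDecision {n : ℕ} (G : Tuple n) (L₀ L₁ : Set (Lin n)) : Prop :=
  (∃ f ∈ L₀, f ∉ Submodule.span (ZMod 2) G.L) ∧
  (∃ f ∈ L₁, f ∉ Submodule.span (ZMod 2) G.L) ∧
  zeroSet (G.ideal : Set (BoolRing n)) ⊆
    zeroSet ((G.ideal ⊔ linIdeal L₀ : Ideal (BoolRing n)) : Set (BoolRing n)) ∪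
    zeroSet ((G.ideal ⊔ linIdeal L₁ : Ideal (BoolRing n)) : Set (BoolRing n))

/-- The number of paths starting at `f`. -/
noncomputable def Tuple.pathsFrom {n : ℕ} (G : Tuple n) (f : Lin n) : ℕ :=
  {l | G.IsPath l ∧ l.head? = some f}.ncard

/-- The number of paths ending in `f`. -/
noncomputable def Tuple.pathsTo {n : ℕ} (G : Tuple n) (f : Lin n) : ℕ :=
  {l | G.IsPath l ∧ l.getLast? = some f}.ncard

/-- The ways to make a decision: the heuristics `MaxReach`, `MaxBottleneck`, `MaxPath`, or
an arbitrary other choice of a decision. -/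
inductive DecisionMethod
  | maxReach
  | maxBottleneck
  | maxPath
  | other

/-- The given method may produce the pair `(L₀, L₁)`. The pairs produced by the three
heuristics are not required to be decisions. -/
def DecisionMethod.Produces {n : ℕ} (m : DecisionMethod) (G : Tuple n)
    (L₀ L₁ : Set (Lin n)) : Prop :=
  match m with
  | .maxReach => ∃ f ∈ G.sources, (∀ g ∈ G.sources, G.pathsFrom g ≤ G.pathsFrom f) ∧
      L₀ = G.desc f ∧ L₁ = {f + 1}
  | .maxBottleneck => ∃ f ∈ G.V,
      (∀ g ∈ G.V, G.pathsTo g + G.pathsFrom g ≤ G.pathsTo f + G.pathsFrom f) ∧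
      L₀ = G.desc f ∧ L₁ = G.desc (f + 1)
  | .maxPath => ∃ (l : List (Lin n)) (f₁ fᵣ : Lin n), G.IsPath l ∧
      (∀ l', G.IsPath l' → l'.length ≤ l.length) ∧
      l.head? = some f₁ ∧ l.getLast? = some fᵣ ∧
      L₀ = {h | ∃ f ∈ l, h = f₁ + f} ∧ L₁ = {f₁ + 1, fᵣ}
  | .other => IsDecision G L₀ L₁

/-! ### The solver `G_2XNF_DPLL` as a transition system -/

/-- The possible results of the solver. -/
inductive Result (n : ℕ)
  | unsat
  | assignment (a : Fin n → ZMod 2)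

/-- The program points, together with the current tuple. -/
inductive Point (n : ℕ)
  /-- start of the solver: propagation by `crGGCP` -/
  | dpllStart (G : Tuple n)
  /-- start of `crGGCP`: call of `GGCP` -/
  | crStart (G : Tuple n)
  /-- `GGCP`: interreduction of `L` -/
  | ggcpReduce (G : Tuple n)
  /-- `GGCP`: pass through the edges, with `L` interreduced -/
  | ggcpLoop (G : Tuple n)
  /-- `crGGCP` after the call of `GGCP`: strongly connected components -/
  | crSCC (G : Tuple n)
  /-- the solver after propagation: in-processing by `tFLS` -/
  | dpllFL (G : Tuple n)
  /-- the solver: test whether `1` is in the span of `L` -/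
  | dpllUnsat (G : Tuple n)
  /-- the solver: test whether `E` is empty -/
  | dpllLinear (G : Tuple n)
  /-- the solver: make a decision by the given method -/
  | dpllDecide (m : DecisionMethod) (G : Tuple n)
  /-- the active call of the solver has returned `r` -/
  | ret (r : Result n)

/-- A configuration: the program point of the active call, and the call stack. For each
pending call, the stack stores the tuple `(L ∪ L₁, V, E)` of its second branch. -/
structure Config (n : ℕ) where
  point : Point n
  stack : List (Tuple n)

/-- Adjoin the linear polynomials in `M` to `L`. -/
def Tuple.adjoin {n : ℕ} (G : Tuple n) (M : Set (Lin n)) : Tuple n := ⟨G.L ∪ M, G.V, G.E⟩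

/-- One step of the solver. All choices that the algorithm leaves open (interreduction,
listing of the components, solution of a linear system, decisions) are nondeterministic. -/
inductive Step {n : ℕ} (σ : MonomialOrder (Fin n)) : Config n → Config n → Prop
  /-- call of `crGGCP` -/
  | callCr (G : Tuple n) (K : List (Tuple n)) :
      Step σ ⟨.dpllStart G, K⟩ ⟨.crStart G, K⟩
  /-- call of `GGCP` -/
  | callGGCP (G : Tuple n) (K : List (Tuple n)) :
      Step σ ⟨.crStart G, K⟩ ⟨.ggcpReduce G, K⟩
  | ggcpInterreduce (G : Tuple n) (K : List (Tuple n)) (L' : Set (Lin n))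
      (h : IsInterreduction σ G.L L') :
      Step σ ⟨.ggcpReduce G, K⟩ ⟨.ggcpLoop ⟨L', G.V, G.E⟩, K⟩
  /-- new linear polynomials were found: start over -/
  | ggcpAgain (G : Tuple n) (K : List (Tuple n)) (h : G.L ≠ (ggcpPass σ G).L) :
      Step σ ⟨.ggcpLoop G, K⟩ ⟨.ggcpReduce (ggcpPass σ G), K⟩
  /-- `GGCP` returns to `crGGCP` -/
  | ggcpReturn (G : Tuple n) (K : List (Tuple n)) (h : G.L = (ggcpPass σ G).L) :
      Step σ ⟨.ggcpLoop G, K⟩ ⟨.crSCC (ggcpPass σ G), K⟩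
  /-- odd number of components: `crGGCP` returns `(𝕃ₙ, ∅, ∅)` -/
  | crOdd (G : Tuple n) (K : List (Tuple n)) (h : Odd G.sccs.ncard) :
      Step σ ⟨.crSCC G, K⟩ ⟨.dpllFL ⟨Set.univ, ∅, ∅⟩, K⟩
  | crAgain (G : Tuple n) (K : List (Tuple n)) (h : ¬ Odd G.sccs.ncard)
      (first : Set (Lin n) → Lin n) (hfirst : ∀ S ∈ G.sccs, first S ∈ S)
      (hne : sccLinerals G first ≠ ∅) :
      Step σ ⟨.crSCC G, K⟩ ⟨.crStart (G.adjoin (sccLinerals G first)), K⟩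
  /-- `crGGCP` returns to the solver -/
  | crReturn (G : Tuple n) (K : List (Tuple n)) (h : ¬ Odd G.sccs.ncard)
      (first : Set (Lin n) → Lin n) (hfirst : ∀ S ∈ G.sccs, first S ∈ S)
      (he : sccLinerals G first = ∅) :
      Step σ ⟨.crSCC G, K⟩ ⟨.dpllFL G, K⟩
  /-- failed linerals `f` were found: adjoin the `f + 1` and propagate again -/
  | flAgain (G : Tuple n) (K : List (Tuple n)) (hne : tFLS G ≠ ∅) :
      Step σ ⟨.dpllFL G, K⟩ ⟨.dpllStart (G.adjoin ((fun f => f + 1) '' tFLS G)), K⟩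
  | flNone (G : Tuple n) (K : List (Tuple n)) (he : tFLS G = ∅) :
      Step σ ⟨.dpllFL G, K⟩ ⟨.dpllUnsat G, K⟩
  | retUnsat (G : Tuple n) (K : List (Tuple n))
      (h : (1 : Lin n) ∈ Submodule.span (ZMod 2) G.L) :
      Step σ ⟨.dpllUnsat G, K⟩ ⟨.ret .unsat, K⟩
  | consistent (G : Tuple n) (K : List (Tuple n))
      (h : (1 : Lin n) ∉ Submodule.span (ZMod 2) G.L) :
      Step σ ⟨.dpllUnsat G, K⟩ ⟨.dpllLinear G, K⟩
  | retSolution (G : Tuple n) (K : List (Tuple n)) (h : G.E = ∅)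
      (a : Fin n → ZMod 2) (ha : a ∈ linZeroSet G.L) :
      Step σ ⟨.dpllLinear G, K⟩ ⟨.ret (.assignment a), K⟩
  /-- some decision method is selected -/
  | selectMethod (G : Tuple n) (K : List (Tuple n)) (h : G.E ≠ ∅) (m : DecisionMethod) :
      Step σ ⟨.dpllLinear G, K⟩ ⟨.dpllDecide m G, K⟩
  /-- recursive call with `(L ∪ L₀, V, E)`; the second branch is put on the stack -/
  | decide (G : Tuple n) (K : List (Tuple n)) (m : DecisionMethod) (L₀ L₁ : Set (Lin n))
      (h : m.Produces G L₀ L₁) :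
      Step σ ⟨.dpllDecide m G, K⟩ ⟨.dpllStart (G.adjoin L₀), G.adjoin L₁ :: K⟩
  /-- the first branch returned an assignment `a`: return `a` -/
  | firstBranchSat (a : Fin n → ZMod 2) (B : Tuple n) (K : List (Tuple n)) :
      Step σ ⟨.ret (.assignment a), B :: K⟩ ⟨.ret (.assignment a), K⟩
  /-- the first branch returned `UNSAT`: return the result of the second branch -/
  | firstBranchUnsat (B : Tuple n) (K : List (Tuple n)) :
      Step σ ⟨.ret .unsat, B :: K⟩ ⟨.dpllStart B, K⟩

/-- The initial configuration of the solver with input `G`. -/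
def start {n : ℕ} (G : Tuple n) : Config n := ⟨.dpllStart G, []⟩

/-- Every run of the solver with input `G` ends after finitely many steps, and a run can end
only by returning a result of the initial call. -/
def Terminates {n : ℕ} (σ : MonomialOrder (Fin n)) (G : Tuple n) : Prop :=
  (¬ ∃ c : ℕ → Config n, c 0 = start G ∧ ∀ i, Step σ (c i) (c (i + 1))) ∧
  ∀ c, Relation.ReflTransGen (Step σ) (start G) c → (∀ d, ¬ Step σ c d) → ∃ r, c = ⟨.ret r, []⟩

/-- Some run of the solver with input `G` returns `r`. -/
def Returns {n : ℕ} (σ : MonomialOrder (Fin n)) (G : Tuple n) (r : Result n) : Prop :=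
  Relation.ReflTransGen (Step σ) (start G) ⟨.ret r, []⟩

end TwoXNF

namespace TwoXNF

/-! ### Evaluation of linear Boolean polynomials -/

/-! An edge `(f, g)` says that `f = 0` forces `g = 0`. Hence the zeros of the ideal of a tuple are
the points of `Tuple.zeros`, and the argument speaks of points instead of ideals.

Correctness. Propagation and failed linerals leave these points unchanged: an edge dropped by `GGCP`
is trivial or has become a linear equation (`zeros_ggcpPass`), a zero is constant on each strongly
connected component, and a common ancestor of `g` and `g + 1` cannot vanish. If the number of
components is odd, the involution `f ↦ f + 1` fixes one of them, so there are no zeros. A decision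
covers the zeros by its two branches. Thus `Config.IsSound` is an invariant: the solutions are
covered by the active call and the pending branches until an assignment is found, and nothing
outside the solution set is ever admitted.

Termination. Each restart and each branch strictly enlarges the span of `L`. The source of this is
`IsNormal.notMem_span`: a nonzero normal remainder modulo an interreduced `L` is outside its span.
So after propagation no vertex, and no sum of two distinct vertices, lies in the span
(`isPropagated_ggcpPass`), and all three heuristics produce decisions
(`Tuple.IsPropagated.isDecision_of_produces`). A potential exponential in the number of elements
outside the span then decreases at every step, branching included (`Config.IsValid.potential_lt`).

Progress. A run is never stuck: interreductions and remainders exist, a consistent linear system has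
a solution, and after propagation the graph is acyclic, so that sources and longest paths exist
(`Config.IsValid.exists_step`). -/

theorem zmod_two_eq_zero_or_one (c : ZMod 2) : c = 0 ∨ c = 1 := by
  revert c; decide

/-- Evaluation of linear Boolean polynomials at a point, as a linear map. -/
noncomputable def Lin.ev {n : ℕ} (a : Fin n → ZMod 2) : Lin n →ₗ[ZMod 2] ZMod 2 :=
  ((evalAt a).toAddMonoidHom.comp (Lin.toBool (n := n)).toAddMonoidHom).toZModLinearMap 2

theorem Lin.ev_apply {n : ℕ} (a : Fin n → ZMod 2) (f : Lin n) :
    Lin.ev a f = evalAt a f.toBool := rfl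

theorem Lin.one_none {n : ℕ} : (1 : Lin n) none = 1 := rfl

theorem Lin.one_some {n : ℕ} (i : Fin n) : (1 : Lin n) (some i) = 0 := rfl

theorem Lin.add_apply {n : ℕ} (f g : Lin n) (t : LinTerm n) : (f + g) t = f t + g t := rfl

theorem Lin.one_ne_zero {n : ℕ} : (1 : Lin n) ≠ 0 := fun h => by
  have h1 : (1 : ZMod 2) = 0 := congrFun h none
  exact absurd h1 (by decide)

theorem Lin.ev_one {n : ℕ} (a : Fin n → ZMod 2) : Lin.ev a 1 = 1 := by
  rw [Lin.ev_apply, evalAt_toBool]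
  simp [Lin.one_none, Lin.one_some]

theorem Lin.add_one_add_one {n : ℕ} (f : Lin n) : f + 1 + 1 = f := by
  rw [add_assoc, ZModModule.add_self, add_zero]

theorem Lin.add_eq_zero_iff {n : ℕ} {f g : Lin n} : f + g = 0 ↔ f = g := by
  rw [← ZModModule.sub_eq_add, sub_eq_zero]

theorem Lin.ev_add_one_eq_zero {n : ℕ} {a : Fin n → ZMod 2} {f : Lin n} :
    Lin.ev a (f + 1) = 0 ↔ Lin.ev a f = 1 := by
  rw [map_add, Lin.ev_one]
  generalize Lin.ev a f = c
  revert c; decide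

theorem Lin.ev_add_eq_zero {n : ℕ} {a : Fin n → ZMod 2} {f g : Lin n} :
    Lin.ev a (f + g) = 0 ↔ Lin.ev a f = Lin.ev a g := by
  rw [map_add]
  generalize Lin.ev a f = c
  generalize Lin.ev a g = d
  revert c d; decide

theorem Lin.ev_eq_zero_of_mem_span {n : ℕ} {a : Fin n → ZMod 2} {L : Set (Lin n)}
    (h : ∀ l ∈ L, Lin.ev a l = 0) {f : Lin n} (hf : f ∈ Submodule.span (ZMod 2) L) :
    Lin.ev a f = 0 := by
  have : Submodule.span (ZMod 2) L ≤ LinearMap.ker (Lin.ev a) := Submodule.span_le.2 h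
  exact this hf

theorem linIdeal_le_ker {n : ℕ} {a : Fin n → ZMod 2} {L : Set (Lin n)} :
    linIdeal L ≤ RingHom.ker (evalAt a) ↔ ∀ l ∈ L, Lin.ev a l = 0 := by
  rw [linIdeal, Ideal.span_le, Set.image_subset_iff]
  rfl

theorem toBool_mem_linIdeal {n : ℕ} {L : Set (Lin n)} {f : Lin n}
    (hf : f ∈ Submodule.span (ZMod 2) L) : f.toBool ∈ linIdeal L := by
  induction hf using Submodule.span_induction with
  | mem l hl => exact Ideal.subset_span ⟨l, hl, rfl⟩
  | zero => rw [map_zero]; exact Ideal.zero_mem _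
  | add f g _ _ hf hg => rw [map_add]; exact Ideal.add_mem _ hf hg
  | smul c f _ hf =>
    rcases zmod_two_eq_zero_or_one c with rfl | rfl
    · rw [zero_smul, map_zero]; exact Ideal.zero_mem _
    · rwa [one_smul]

theorem mem_zeroSet_ideal {n : ℕ} {I : Ideal (BoolRing n)} {a : Fin n → ZMod 2} :
    a ∈ zeroSet (I : Set (BoolRing n)) ↔ I ≤ RingHom.ker (evalAt a) := Iff.rfl

theorem mem_linZeroSet {n : ℕ} {L : Set (Lin n)} {a : Fin n → ZMod 2} :
    a ∈ linZeroSet L ↔ ∀ l ∈ L, Lin.ev a l = 0 := by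
  simp only [linZeroSet, zeroSet, Set.mem_ofPred_eq, Set.forall_mem_image]
  rfl

/-- A consistent linear system has a solution. -/
theorem linZeroSet_nonempty {n : ℕ} {L : Set (Lin n)}
    (h : (1 : Lin n) ∉ Submodule.span (ZMod 2) L) : (linZeroSet L).Nonempty := by
  classical
  -- A functional that kills `L` but not `1` is evaluation at the point whose coordinates are its
  -- values at the variables `e i`.
  obtain ⟨φ, hφ1, hφ⟩ := Submodule.exists_le_ker_of_notMem h
  let e : Fin n → Lin n := fun i t => if t = some i then 1 else 0
  refine ⟨fun i => φ (e i), mem_linZeroSet.2 fun l hl => ?_⟩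
  have h1 : φ 1 = 1 := (zmod_two_eq_zero_or_one _).resolve_left hφ1
  have hl0 : φ l = 0 := hφ (Submodule.subset_span hl)
  have hsum : l = l none • (1 : Lin n) + ∑ i, l (some i) • e i := by
    have happ : ∀ (s : Finset (Fin n)) (t : LinTerm n),
        (∑ i ∈ s, l (some i) • e i : Lin n) t = ∑ i ∈ s, l (some i) * e i t := by
      intro s t
      induction s using Finset.induction_on with
      | empty => rfl
      | insert i s hi ih => rw [Finset.sum_insert hi, Finset.sum_insert hi, ← ih]; rfl
    funext t
    rw [Lin.add_apply, happ]
    change _ = l none * (1 : Lin n) t + _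
    cases t with
    | none => simp [Lin.one_none, e]
    | some j => simp [Lin.one_some, e]
  rw [Lin.ev_apply, evalAt_toBool]
  rw [hsum, map_add, map_smul, map_sum, h1] at hl0
  simpa using hl0

/-! ### Leading terms and normal remainders -/

variable {n : ℕ} {σ : MonomialOrder (Fin n)}

theorem LinTerm.exponent_injective : Function.Injective (LinTerm.exponent (n := n)) := by
  intro s t h
  cases s with
  | none =>
    cases t with
    | none => rfl
    | some j => exact absurd h.symm (by simp [LinTerm.exponent])
  | some i =>
    cases t with
    | none => exact absurd h (by simp [LinTerm.exponent])
    | some j =>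
      simp only [LinTerm.exponent] at h
      rw [Finsupp.single_left_injective one_ne_zero h]

theorem toSyn_exponent_injective (σ : MonomialOrder (Fin n)) :
    Function.Injective fun t : LinTerm n => σ.toSyn t.exponent :=
  σ.toSyn.injective.comp LinTerm.exponent_injective

theorem exists_isLT (σ : MonomialOrder (Fin n)) {f : Lin n} (hf : f ≠ 0) : ∃ t, IsLT σ f t := by
  have hne : f.supp.Nonempty := by
    by_contra h
    refine hf (funext fun t => ?_)
    by_contra ht
    exact h ⟨t, ht⟩
  obtain ⟨t, ht, hmax⟩ := Set.exists_max_image f.supp (fun t => σ.toSyn t.exponent)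
    (Set.toFinite _) hne
  exact ⟨t, ht, hmax⟩

theorem IsLT.unique {f : Lin n} {s t : LinTerm n} (hs : IsLT σ f s) (ht : IsLT σ f t) : s = t :=
  toSyn_exponent_injective σ (le_antisymm (ht.2 s hs.1) (hs.2 t ht.1))

theorem IsLT.apply_eq_one {f : Lin n} {t : LinTerm n} (h : IsLT σ f t) : f t = 1 :=
  (zmod_two_eq_zero_or_one _).resolve_left h.1

theorem IsLT.eq_one {f : Lin n} (h : IsLT σ f none) : f = 1 := by
  funext t
  cases t with
  | none => exact h.apply_eq_one
  | some i =>
    by_contra hi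
    have h1 := h.2 (some i) hi
    have h2 : σ.toSyn (LinTerm.exponent none) ≤ σ.toSyn (LinTerm.exponent (some i)) :=
      σ.toSyn_monotone (by simp [LinTerm.exponent])
    exact absurd (toSyn_exponent_injective σ (le_antisymm h1 h2)) (by simp)

/-- In degree at most one, divisibility is equality except for the divisor `1`; so normal remainders
are a matter of Gaussian elimination unless `1` is a leading term. -/
theorem LinTerm.exponent_le_iff {s t : LinTerm n} :
    s.exponent ≤ t.exponent ↔ s = none ∨ s = t := by
  constructor
  · intro h
    cases s with
    | none => exact Or.inl rfl
    | some i =>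
      right
      have hi := h i
      cases t with
      | none => simp [LinTerm.exponent] at hi
      | some j =>
        by_contra hne
        have hij : j ≠ i := fun h' => hne (by rw [h'])
        simp [LinTerm.exponent, Finsupp.single_eq_of_ne' hij] at hi
  · rintro (rfl | rfl)
    · simp [LinTerm.exponent]
    · exact le_rfl

/-- Modulo the span of `L`, every `f` is congruent to some `r` that involves none of the leading
terms of `L`. -/
theorem exists_reduced (σ : MonomialOrder (Fin n)) (L : Set (Lin n)) (f : Lin n) :
    ∃ r, f + r ∈ Submodule.span (ZMod 2) L ∧ ∀ l ∈ L, ∀ t, IsLT σ l t → t ∉ r.supp := by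
  classical
  suffices h : ∀ s : Finset (LinTerm n), ∃ r, f + r ∈ Submodule.span (ZMod 2) L ∧
      ∀ t ∈ s, ∀ l ∈ L, IsLT σ l t → t ∉ r.supp by
    obtain ⟨r, hr, hs⟩ := h Finset.univ
    exact ⟨r, hr, fun l hl t ht => hs t (Finset.mem_univ t) l hl ht⟩
  intro s
  -- Terms are eliminated from the largest down: adding `l` with leading term `t` cannot bring back
  -- a larger term, already treated.
  induction s using Finset.induction_on_min_value (fun t : LinTerm n => σ.toSyn t.exponent) with
  | empty => exact ⟨f, by rw [ZModModule.add_self]; exact Submodule.zero_mem _, by simp⟩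
  | insert t s hts hmin ih =>
    obtain ⟨r, hr, hs⟩ := ih
    by_cases hex : ∃ l ∈ L, IsLT σ l t ∧ t ∈ r.supp
    · obtain ⟨l, hl, hlt, htr⟩ := hex
      refine ⟨r + l, ?_, fun u hu m hm hmu => ?_⟩
      · rw [← add_assoc]
        exact Submodule.add_mem _ hr (Submodule.subset_span hl)
      · rcases Finset.mem_insert.1 hu with rfl | hus
        · have h1 : r u = 1 := (zmod_two_eq_zero_or_one _).resolve_left htr
          intro hmem
          refine hmem ?_
          rw [Lin.add_apply, h1, hlt.apply_eq_one]
          decide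
        · have hlu : l u = 0 := by
            by_contra hlu
            exact hts (toSyn_exponent_injective σ (le_antisymm (hmin u hus) (hlt.2 u hlu)) ▸ hus)
          have := hs u hus m hm hmu
          simp only [Lin.supp, Set.mem_ofPred_eq, Lin.add_apply, hlu, add_zero] at this ⊢
          exact this
    · refine ⟨r, hr, fun u hu m hm hmu hmem => ?_⟩
      rcases Finset.mem_insert.1 hu with rfl | hus
      · exact hex ⟨m, hm, hmu, hmem⟩
      · exact hs u hus m hm hmu hmem

/-- No term of `r` is divisible by a leading term of an element of `L`. -/
def IsNormal (σ : MonomialOrder (Fin n)) (L : Set (Lin n)) (r : Lin n) : Prop :=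
  ∀ l ∈ L, ∀ t, IsLT σ l t → ∀ u ∈ r.supp, ¬ LinTerm.exponent t ≤ LinTerm.exponent u

theorem IsNR.isNormal {L : Set (Lin n)} {f r : Lin n} (h : IsNR σ L f r) : IsNormal σ L r := h.2

theorem IsNormal.add {L : Set (Lin n)} {f g : Lin n} (hf : IsNormal σ L f)
    (hg : IsNormal σ L g) : IsNormal σ L (f + g) := by
  intro l hl t ht u hu
  by_cases huf : f u = 0
  · refine hg l hl t ht u fun hug => hu ?_
    rw [Lin.add_apply, huf, hug, add_zero]
  · exact hf l hl t ht u huf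

/-- The constant `1` is normal if there is some nonzero normal element. -/
theorem IsNormal.one {L : Set (Lin n)} {f : Lin n} (hf : IsNormal σ L f) (h0 : f ≠ 0) :
    IsNormal σ L (1 : Lin n) := by
  intro l hl t ht u hu hle
  cases u with
  | some i => exact hu (Lin.one_some i)
  | none =>
    have htn : t = none := by simpa [LinTerm.exponent_le_iff] using hle
    -- A leading term `1` in `L` would divide every term of `f`.
    obtain ⟨v, hv⟩ := exists_isLT σ h0
    exact hf l hl t ht v hv.1 (LinTerm.exponent_le_iff.2 (Or.inl htn))

/-- Normal remainders exist. -/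
theorem exists_isNR (σ : MonomialOrder (Fin n)) (L : Set (Lin n)) (f : Lin n) :
    ∃ r, IsNR σ L f r := by
  by_cases h1 : (1 : Lin n) ∈ L
  · refine ⟨0, ?_, fun l _ t _ u hu => absurd rfl hu⟩
    have : (1 : BoolRing n) ∈ linIdeal L := by
      refine Ideal.subset_span ⟨1, h1, eq_of_evalAt_eq fun a => ?_⟩
      rw [← Lin.ev_apply, Lin.ev_one, map_one]
    rw [(Ideal.eq_top_iff_one _).2 this]
    exact Submodule.mem_top
  · obtain ⟨r, hr, hL⟩ := exists_reduced σ L f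
    refine ⟨r, ?_, fun l hl t ht u hu hle => ?_⟩
    · rw [ZModModule.sub_eq_add]
      exact toBool_mem_linIdeal hr
    · rcases LinTerm.exponent_le_iff.1 hle with rfl | rfl
      · exact h1 (ht.eq_one ▸ hl)
      · exact hL l hl t ht hu

theorem IsNR.ev_eq {L : Set (Lin n)} {f r : Lin n} (h : IsNR σ L f r) {a : Fin n → ZMod 2}
    (ha : ∀ l ∈ L, Lin.ev a l = 0) : Lin.ev a f = Lin.ev a r := by
  have := linIdeal_le_ker.2 ha h.1
  rw [RingHom.mem_ker, ← Lin.ev_apply, map_sub] at this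
  exact sub_eq_zero.1 this

/-- The leading term of a suitable element of an interreduced set occurs in each nonzero element
of the span. -/
theorem exists_isLT_mem_supp {L : Set (Lin n)} (h0 : (0 : Lin n) ∉ L)
    (hinj : ∀ f ∈ L, ∀ g ∈ L, ∀ t, IsLT σ f t → IsLT σ g t → f = g) {f : Lin n} (hf : f ≠ 0)
    (hmem : f ∈ Submodule.span (ZMod 2) L) : ∃ l ∈ L, ∃ t, IsLT σ l t ∧ t ∈ f.supp := by
  classical
  have hlt : ∀ l : Lin n, ∃ t, l ≠ 0 → IsLT σ l t := fun l => by
    by_cases hl : l = 0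
    · exact ⟨none, fun h => absurd hl h⟩
    · exact (exists_isLT σ hl).imp fun t ht _ => ht
  choose lt hlt using hlt
  obtain ⟨c, hc, rfl⟩ := Submodule.mem_span_set.1 hmem
  have hne : c.support.Nonempty := by
    by_contra h
    refine hf ?_
    rw [Finset.not_nonempty_iff_eq_empty, Finsupp.support_eq_empty] at h
    rw [h, Finsupp.sum_zero_index]
  have hlt' : ∀ l ∈ c.support, IsLT σ l (lt l) := fun l hl =>
    hlt l fun h => h0 (h ▸ hc hl)
  -- The largest leading term among the summands occurs in only one of them, so it does not cancel.
  obtain ⟨l, hl, hmax⟩ := Finset.exists_max_image c.support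
    (fun l => σ.toSyn (lt l).exponent) hne
  refine ⟨l, hc hl, lt l, hlt' l hl, ?_⟩
  have happ : ∀ s : Finset (Lin n),
      (∑ m ∈ s, c m • m : Lin n) (lt l) = ∑ m ∈ s, c m * m (lt l) := by
    intro s
    induction s using Finset.induction_on with
    | empty => rfl
    | insert i s hi ih => rw [Finset.sum_insert hi, Finset.sum_insert hi, ← ih]; rfl
  change (∑ m ∈ c.support, c m • m : Lin n) (lt l) ≠ 0
  rw [happ, Finset.sum_eq_single_of_mem l hl]
  · exact mul_ne_zero (Finsupp.mem_support_iff.1 hl) (hlt' l hl).1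
  · intro m hm hml
    have : m (lt l) = 0 := by
      by_contra hne0
      have h2 := le_antisymm ((hlt' m hm).2 _ hne0) (hmax m hm)
      have h3 := toSyn_exponent_injective σ h2
      exact hml (hinj m (hc hm) l (hc hl) (lt l) (h3 ▸ hlt' m hm) (hlt' l hl))
    rw [this, mul_zero]

/-- `L` is interreduced: its elements are nonzero with pairwise distinct leading terms. -/
def Interreduced (σ : MonomialOrder (Fin n)) (L : Set (Lin n)) : Prop :=
  (0 : Lin n) ∉ L ∧ ∀ f ∈ L, ∀ g ∈ L, ∀ t, IsLT σ f t → IsLT σ g t → f = g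

theorem IsNormal.notMem_span {L : Set (Lin n)} (hL : Interreduced σ L) {f : Lin n}
    (hf : IsNormal σ L f) (h0 : f ≠ 0) : f ∉ Submodule.span (ZMod 2) L := fun h => by
  obtain ⟨l, hl, t, ht, htf⟩ := exists_isLT_mem_supp hL.1 hL.2 h0 h
  exact hf l hl t ht t htf le_rfl

theorem exists_isInterreduction (σ : MonomialOrder (Fin n)) (L : Set (Lin n)) :
    ∃ L', IsInterreduction σ L L' := by
  have hch : ∀ t : LinTerm n, ∃ p : Lin n,
      (∃ f ∈ Submodule.span (ZMod 2) L, IsLT σ f t) →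
        p ∈ Submodule.span (ZMod 2) L ∧ IsLT σ p t := fun t => by
    by_cases h : ∃ f ∈ Submodule.span (ZMod 2) L, IsLT σ f t
    · exact h.imp fun f hf _ => hf
    · exact ⟨0, fun h' => absurd h' h⟩
  choose p hp using hch
  -- One element of the span is chosen for each leading term occurring there. An element of the span
  -- then reduces to `0`, since the leading term of a nonzero reduced element would be one of those
  -- excluded.
  let L' : Set (Lin n) :=
    {f | ∃ t, (∃ f ∈ Submodule.span (ZMod 2) L, IsLT σ f t) ∧ f = p t}
  have hle : Submodule.span (ZMod 2) L' ≤ Submodule.span (ZMod 2) L := by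
    rw [Submodule.span_le]
    rintro _ ⟨t, ht, rfl⟩
    exact (hp t ht).1
  refine ⟨L', le_antisymm hle fun f hf => ?_, ?_, ?_⟩
  · obtain ⟨r, hr, hL⟩ := exists_reduced σ L' f
    have hr0 : r = 0 := by
      by_contra hr0
      obtain ⟨t, ht⟩ := exists_isLT σ hr0
      have hrm : r ∈ Submodule.span (ZMod 2) L := by
        have := Submodule.add_mem _ hf (hle hr)
        rwa [← add_assoc, ZModModule.add_self, zero_add] at this
      have hex : ∃ f ∈ Submodule.span (ZMod 2) L, IsLT σ f t := ⟨r, hrm, ht⟩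
      exact hL (p t) ⟨t, hex, rfl⟩ t (hp t hex).2 ht.1
    rwa [hr0, add_zero] at hr
  · rintro ⟨t, ht, h⟩
    have := (hp t ht).2.1
    rw [← h] at this
    exact this rfl
  · rintro _ ⟨s, hs, rfl⟩ _ ⟨t, ht, rfl⟩ u hu hu'
    rw [(hp s hs).2.unique hu, (hp t ht).2.unique hu']

/-! ### Zeros and reachability -/

/-- The edge relation. -/
def Tuple.Adj (G : Tuple n) (f g : Lin n) : Prop := (f, g) ∈ G.E

/-- The points at which `L` vanishes and which satisfy all implications given by the edges. -/
def Tuple.zeros (G : Tuple n) : Set (Fin n → ZMod 2) :=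
  {a | (∀ l ∈ G.L, Lin.ev a l = 0) ∧ ∀ f g, G.Adj f g → Lin.ev a f = 0 → Lin.ev a g = 0}

/-- Over `𝔽₂`, the equation `f * g = 0` is the implication from `f + 1 = 0` to `g = 0`. -/
theorem Tuple.zeroSet_ideal (G : Tuple n) :
    zeroSet (G.ideal : Set (BoolRing n)) = G.zeros := by
  ext a
  rw [mem_zeroSet_ideal, Tuple.ideal, sup_le_iff, linIdeal_le_ker, Ideal.span_le]
  refine and_congr_right fun _ => ⟨fun h f g hfg hf => ?_, ?_⟩
  · have : ((f + 1).toBool * g.toBool : BoolRing n) ∈ RingHom.ker (evalAt a) :=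
      h ⟨f + 1, g, by rwa [Lin.add_one_add_one], rfl⟩
    rw [RingHom.mem_ker, map_mul, ← Lin.ev_apply, ← Lin.ev_apply, map_add, hf, Lin.ev_one,
      zero_add, one_mul] at this
    exact this
  · rintro h _ ⟨f, g, hfg, rfl⟩
    rw [SetLike.mem_coe, RingHom.mem_ker, map_mul, ← Lin.ev_apply, ← Lin.ev_apply]
    rcases zmod_two_eq_zero_or_one (Lin.ev a f) with hf | hf
    · rw [hf, zero_mul]
    · rw [h _ _ hfg (Lin.ev_add_one_eq_zero.2 hf), mul_zero]

theorem Tuple.mem_zeros_adjoin {G : Tuple n} {M : Set (Lin n)} {a : Fin n → ZMod 2} :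
    a ∈ (G.adjoin M).zeros ↔ a ∈ G.zeros ∧ ∀ l ∈ M, Lin.ev a l = 0 := by
  constructor
  · rintro ⟨hL, hE⟩
    exact ⟨⟨fun l hl => hL l (Or.inl hl), hE⟩, fun l hl => hL l (Or.inr hl)⟩
  · rintro ⟨⟨hL, hE⟩, hM⟩
    exact ⟨fun l hl => hl.elim (hL l) (hM l), hE⟩

theorem Tuple.zeroSet_ideal_sup (G : Tuple n) (M : Set (Lin n)) :
    zeroSet ((G.ideal ⊔ linIdeal M : Ideal (BoolRing n)) : Set (BoolRing n))
      = (G.adjoin M).zeros := by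
  ext a
  rw [mem_zeroSet_ideal, sup_le_iff, linIdeal_le_ker, ← mem_zeroSet_ideal, zeroSet_ideal,
    mem_zeros_adjoin]

theorem Tuple.one_notMem_span {G : Tuple n} {a : Fin n → ZMod 2} (ha : a ∈ G.zeros) :
    (1 : Lin n) ∉ Submodule.span (ZMod 2) G.L := fun h => by
  have := Lin.ev_eq_zero_of_mem_span ha.1 h
  rw [Lin.ev_one] at this
  exact one_ne_zero this

theorem Tuple.ev_eq_zero_of_reflTransGen {G : Tuple n} {a : Fin n → ZMod 2} (ha : a ∈ G.zeros)
    {f g : Lin n} (h : Relation.ReflTransGen G.Adj f g) (hf : Lin.ev a f = 0) :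
    Lin.ev a g = 0 := by
  induction h with
  | refl => exact hf
  | tail _ hbc ih => exact ha.2 _ _ hbc ih

/-- The edges join vertices, and they come in skew-symmetric pairs. -/
structure Tuple.IsSkew (G : Tuple n) : Prop where
  edge_mem : ∀ f g, G.Adj f g → f ∈ G.V ∧ g ∈ G.V
  skew : ∀ f g, G.Adj f g → G.Adj (g + 1) (f + 1)

/-- This is all of the IGS that termination needs, and unlike the identity of ideals it survives the
adjunction of decisions. -/
theorem IsIGS.isSkew {F : XNF n} {G : Tuple n} (h : IsIGS F G) : G.IsSkew where
  edge_mem f g hfg := h.edge_mem (f, g) hfg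
  skew f g hfg := h.skew (f + 1) g (by rwa [Lin.add_one_add_one])

theorem Tuple.IsSkew.adjoin {G : Tuple n} (h : G.IsSkew) (M : Set (Lin n)) :
    (G.adjoin M).IsSkew := ⟨h.edge_mem, h.skew⟩

theorem Tuple.reaches_iff {G : Tuple n} (hG : ∀ f g, G.Adj f g → f ∈ G.V ∧ g ∈ G.V)
    {f g : Lin n} : G.Reaches f g ↔ f ∈ G.V ∧ Relation.ReflTransGen G.Adj f g := by
  constructor
  · rintro ⟨l, ⟨hne, hV, hc⟩, hf, hg⟩
    rw [List.head?_eq_some_head hne, Option.some_inj] at hf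
    rw [List.getLast?_eq_some_getLast hne, Option.some_inj] at hg
    subst hf hg
    exact ⟨hV _ (List.head_mem hne), List.relationReflTransGen_of_exists_isChain l hc hne⟩
  · rintro ⟨hf, h⟩
    induction h using Relation.ReflTransGen.head_induction_on with
    | refl => exact ⟨[g], ⟨by simp, by simpa using hf, List.isChain_singleton _⟩, rfl, rfl⟩
    | @head f b hfb _ ih =>
      obtain ⟨l, ⟨hne, hV, hc⟩, hb, hg⟩ := ih (hG f b hfb).2
      refine ⟨f :: l, ⟨by simp, ?_, ?_⟩, rfl, ?_⟩
      · intro h hh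
        rcases List.mem_cons.1 hh with rfl | hh
        · exact hf
        · exact hV h hh
      · cases l with
        | nil => exact absurd rfl hne
        | cons c l =>
          obtain rfl : c = b := by simpa using hb
          exact List.IsChain.cons_cons hfb hc
      · cases l with
        | nil => exact absurd rfl hne
        | cons c l => rw [List.getLast?_cons_cons]; exact hg

theorem Tuple.Reaches.ev_eq_zero {G : Tuple n} (hG : G.IsSkew) {a : Fin n → ZMod 2}
    (ha : a ∈ G.zeros) {f g : Lin n} (h : G.Reaches f g) (hf : Lin.ev a f = 0) :
    Lin.ev a g = 0 :=
  ev_eq_zero_of_reflTransGen ha ((reaches_iff hG.edge_mem).1 h).2 hf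

theorem Tuple.ev_eq_zero_of_mem_desc {G : Tuple n} (hG : G.IsSkew) {a : Fin n → ZMod 2}
    (ha : a ∈ G.zeros) {f g : Lin n} (h : g ∈ G.desc f) (hf : Lin.ev a f = 0) :
    Lin.ev a g = 0 := by
  rcases h with rfl | ⟨-, h⟩
  · exact hf
  · exact h.ev_eq_zero hG ha hf

theorem Tuple.ev_eq_zero_of_mem_anc {G : Tuple n} (hG : G.IsSkew) {a : Fin n → ZMod 2}
    (ha : a ∈ G.zeros) {f g : Lin n} (h : f ∈ G.anc g) (hf : Lin.ev a f = 0) :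
    Lin.ev a g = 0 := by
  rcases h with rfl | ⟨-, h⟩
  · exact hf
  · exact h.ev_eq_zero hG ha hf

/-- The failed linerals found by `tFLS` take the value `1` at all zeros. -/
theorem Tuple.ev_eq_one_of_mem_tFLS {G : Tuple n} (hG : G.IsSkew) {a : Fin n → ZMod 2}
    (ha : a ∈ G.zeros) {f : Lin n} (hf : f ∈ tFLS G) : Lin.ev a f = 1 := by
  obtain ⟨p, -, h0, h1⟩ := hf
  refine (zmod_two_eq_zero_or_one _).resolve_left fun h => ?_
  have e0 := ev_eq_zero_of_mem_anc hG ha h0 h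
  have e1 := ev_eq_zero_of_mem_anc hG ha h1 h
  rw [Lin.ev_add_one_eq_zero, e0] at e1
  exact zero_ne_one e1

/-! ### Strongly connected components -/

theorem Tuple.IsSkew.adj_reflTransGen {G : Tuple n} (hG : G.IsSkew) {f g : Lin n}
    (h : Relation.ReflTransGen G.Adj f g) :
    Relation.ReflTransGen G.Adj (g + 1) (f + 1) := by
  induction h with
  | refl => exact .refl
  | tail _ hbc ih => exact .head (hG.skew _ _ hbc) ih

/-- A zero takes the same value at all elements of a strongly connected component. -/
theorem Tuple.ev_eq_of_mem_scc {G : Tuple n} (hG : G.IsSkew) {a : Fin n → ZMod 2}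
    (ha : a ∈ G.zeros) {S : Set (Lin n)} (hS : S ∈ G.sccs) {f g : Lin n} (hf : f ∈ S)
    (hg : g ∈ S) : Lin.ev a f = Lin.ev a g := by
  have h1 := (hS.1.2.2 f hf g hg).ev_eq_zero hG ha
  have h2 := (hS.1.2.2 g hg f hf).ev_eq_zero hG ha
  rcases zmod_two_eq_zero_or_one (Lin.ev a f) with h | h
  · rw [h, h1 h]
  · rcases zmod_two_eq_zero_or_one (Lin.ev a g) with h' | h'
    · rw [h', h2 h']
    · rw [h, h']

theorem Tuple.exists_scc {G : Tuple n} {S : Set (Lin n)}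
    (hS : S.Nonempty ∧ S ⊆ G.V ∧ ∀ f ∈ S, ∀ g ∈ S, G.Reaches f g) : ∃ T ∈ G.sccs, S ⊆ T := by
  have hfin : Finite (Set (Lin n)) := inferInstance
  obtain ⟨T, hST, hT⟩ := Finite.exists_le_maximal
    (p := fun S : Set (Lin n) => S.Nonempty ∧ S ⊆ G.V ∧ ∀ f ∈ S, ∀ g ∈ S, G.Reaches f g) hS
  exact ⟨T, hT, hST⟩

/-- Every vertex is an end of an edge, and there are no edges from a vertex to itself. -/
structure Tuple.IsClean (G : Tuple n) : Prop extends G.IsSkew where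
  exists_edge : ∀ f ∈ G.V, ∃ g, G.Adj f g ∨ G.Adj g f
  no_loop : ∀ f, ¬ G.Adj f f

theorem Tuple.IsClean.add_one_mem {G : Tuple n} (hG : G.IsClean) {f : Lin n} (hf : f ∈ G.V) :
    f + 1 ∈ G.V := by
  obtain ⟨g, h | h⟩ := hG.exists_edge f hf
  · exact (hG.edge_mem _ _ (hG.skew _ _ h)).2
  · exact (hG.edge_mem _ _ (hG.skew _ _ h)).1

/-- Adding `1` reverses all edges, so it preserves strong connectedness; as an involution it also
preserves maximality. -/
theorem Tuple.IsClean.image_add_one_scc {G : Tuple n} (hG : G.IsClean) {S : Set (Lin n)}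
    (hS : S ∈ G.sccs) : (fun f => f + 1) '' S ∈ G.sccs := by
  have key : ∀ T : Set (Lin n), (T.Nonempty ∧ T ⊆ G.V ∧ ∀ f ∈ T, ∀ g ∈ T, G.Reaches f g) →
      (((fun f => f + 1) '' T).Nonempty ∧ (fun f => f + 1) '' T ⊆ G.V ∧
        ∀ f ∈ (fun f => f + 1) '' T, ∀ g ∈ (fun f => f + 1) '' T, G.Reaches f g) := by
    rintro T ⟨hne, hV, hT⟩
    refine ⟨hne.image _, ?_, ?_⟩
    · rintro _ ⟨f, hf, rfl⟩
      exact hG.add_one_mem (hV hf)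
    · rintro _ ⟨f, hf, rfl⟩ _ ⟨g, hg, rfl⟩
      exact (reaches_iff hG.edge_mem).2 ⟨hG.add_one_mem (hV hf),
        hG.adj_reflTransGen ((reaches_iff hG.edge_mem).1 (hT g hg f hf)).2⟩
  refine ⟨key S hS.1, fun T hT hST => ?_⟩
  have hS' : S ≤ (fun f => f + 1) '' T := fun f hf =>
    ⟨f + 1, hST ⟨f, hf, rfl⟩, Lin.add_one_add_one f⟩
  have := hS.2 (key T hT) hS'
  intro f hf
  exact ⟨f + 1, this ⟨f, hf, rfl⟩, Lin.add_one_add_one f⟩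

/-- If the number of strongly connected components is odd, then some component contains
complementary vertices, and there are no zeros. -/
theorem Tuple.IsClean.zeros_eq_empty_of_odd {G : Tuple n} (hG : G.IsClean)
    (hodd : Odd G.sccs.ncard) : G.zeros = ∅ := by
  classical
  have hfin : G.sccs.Finite := Set.toFinite _
  by_contra hne
  obtain ⟨a, ha⟩ := Set.nonempty_iff_ne_empty.2 hne
  -- The components are counted modulo 2. A component fixed by the involution contains some `f` and
  -- `f + 1`, on which the zero `a` would have to agree.
  have hsum : ∑ _S ∈ hfin.toFinset, (1 : ZMod 2) = 0 := by
    refine Finset.sum_involution (fun S _ => (fun f => f + 1) '' S) (fun _ _ => by decide) ?_ ?_ ?_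
    · intro S hS _ heq
      have hS' := hfin.mem_toFinset.1 hS
      obtain ⟨f, hf⟩ := hS'.1.1
      have hf1 : f + 1 ∈ S := by rw [← heq]; exact ⟨f, hf, rfl⟩
      have := ev_eq_of_mem_scc hG.toIsSkew ha hS' hf hf1
      rw [map_add, Lin.ev_one] at this
      simp at this
    · intro S hS
      exact hfin.mem_toFinset.2 (hG.image_add_one_scc (hfin.mem_toFinset.1 hS))
    · intro S _
      rw [Set.image_image]
      simp only [Lin.add_one_add_one, Set.image_id']
  rw [Finset.sum_const, nsmul_one, ← Set.ncard_eq_toFinset_card _ hfin,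
    ZMod.natCast_eq_zero_iff_even] at hsum
  exact Nat.not_even_iff_odd.2 hodd hsum

/-- There are no directed cycles. -/
def Tuple.Acyclic (G : Tuple n) : Prop := ∀ f, ¬ Relation.TransGen G.Adj f f

theorem Tuple.IsClean.acyclic {G : Tuple n} (hG : G.IsClean) {first : Set (Lin n) → Lin n}
    (h : sccLinerals G first = ∅) : G.Acyclic := by
  intro f hf
  obtain ⟨g, hfg, hgf⟩ := Relation.TransGen.head'_iff.1 hf
  have hV := hG.edge_mem f g hfg
  -- An edge on a cycle puts its two distinct ends into one component, whereas an empty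
  -- `sccLinerals` makes all components singletons.
  obtain ⟨T, hT, hsub⟩ := exists_scc (G := G) (S := {f, g}) ⟨⟨f, Or.inl rfl⟩, by
    rintro _ (rfl | rfl)
    exacts [hV.1, hV.2], by
    simp only [reaches_iff hG.edge_mem]
    rintro _ (rfl | rfl) _ (rfl | rfl)
    exacts [⟨hV.1, .refl⟩, ⟨hV.1, .single hfg⟩, ⟨hV.2, hgf⟩, ⟨hV.2, .refl⟩]⟩
  have hne : f ≠ g := fun h => hG.no_loop f (h ▸ hfg)
  have hall : ∀ e ∈ T, e = first T := fun e he => by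
    by_contra hne
    have : first T + e ∈ sccLinerals G first := ⟨T, hT, e, he, hne, rfl⟩
    rw [h] at this
    exact this
  exact hne ((hall f (hsub (Or.inl rfl))).trans (hall g (hsub (Or.inr rfl))).symm)

theorem Tuple.Acyclic.exists_source {G : Tuple n} (hG : G.Acyclic) (hV : G.V.Nonempty)
    (hE : ∀ f g, G.Adj f g → f ∈ G.V ∧ g ∈ G.V) : G.sources.Nonempty := by
  have : Std.Irrefl (Relation.TransGen G.Adj) := ⟨hG⟩
  obtain ⟨f, hf, hmin⟩ :=
    (Finite.wellFounded_of_trans_of_irrefl (Relation.TransGen G.Adj)).has_min G.V hV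
  exact ⟨f, hf, fun g hg => hmin g (hE g f hg).1 (.single hg)⟩

theorem Tuple.Acyclic.exists_longest_path {G : Tuple n} (hG : G.Acyclic) (hV : G.V.Nonempty) :
    ∃ l, G.IsPath l ∧ ∀ l', G.IsPath l' → l'.length ≤ l.length := by
  have hfin : Fintype (Lin n) := Fintype.ofFinite _
  have hbdd : ∀ l, G.IsPath l → l.length ≤ Fintype.card (Lin n) := by
    rintro l ⟨-, -, hc⟩
    -- By acyclicity a path repeats no vertex, which bounds its length.
    have h1 : l.IsChain (Relation.TransGen G.Adj) := hc.imp fun f g hfg => .single hfg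
    have h2 : l.Nodup := (List.isChain_iff_pairwise.1 h1).imp fun {f g} hfg => by
      rintro rfl
      exact hG _ hfg
    exact h2.length_le_card
  obtain ⟨f, hf⟩ := hV
  obtain ⟨l, hl, hmax⟩ := Nat.sSup_mem (s := {k | ∃ l, G.IsPath l ∧ l.length = k})
    ⟨1, [f], ⟨by simp, by simpa using hf, List.isChain_singleton _⟩, rfl⟩
    ⟨Fintype.card (Lin n), by rintro _ ⟨l, hl, rfl⟩; exact hbdd l hl⟩
  refine ⟨l, hl, fun l' hl' => ?_⟩
  rw [hmax]
  exact le_csSup ⟨Fintype.card (Lin n), by rintro _ ⟨l, hl, rfl⟩; exact hbdd l hl⟩ ⟨l', hl', rfl⟩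

/-! ### Gaussian constraint propagation -/

theorem Tuple.zeros_of_span_eq {G : Tuple n} {L' : Set (Lin n)}
    (h : Submodule.span (ZMod 2) L' = Submodule.span (ZMod 2) G.L) :
    (⟨L', G.V, G.E⟩ : Tuple n).zeros = G.zeros := by
  ext a
  refine and_congr_left fun _ => ⟨fun hL l hl => ?_, fun hL l hl => ?_⟩
  · exact Lin.ev_eq_zero_of_mem_span hL (h ▸ Submodule.subset_span hl)
  · exact Lin.ev_eq_zero_of_mem_span hL (h ▸ Submodule.subset_span hl)

/-- A pass of `GGCP` does not change the zeros. -/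
theorem zeros_ggcpPass (σ : MonomialOrder (Fin n)) (G : Tuple n) :
    (ggcpPass σ G).zeros = G.zeros := by
  ext a
  constructor
  · rintro ⟨hL, hE⟩
    have hL0 : ∀ l ∈ G.L, Lin.ev a l = 0 := fun l hl => hL l (Or.inl (Or.inl hl))
    refine ⟨hL0, fun f g hfg hf => ?_⟩
    obtain ⟨f', hf'⟩ := exists_isNR σ G.L f
    obtain ⟨g', hg'⟩ := exists_isNR σ G.L g
    have hmem : (f', g') ∈ remainderPairs σ G := ⟨f, g, hfg, hf', hg'⟩
    rw [hf'.ev_eq hL0] at hf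
    rw [hg'.ev_eq hL0]
    -- Either the edge is kept, or it is a trivial implication, or it yields one of the equations
    -- adjoined to `L`.
    by_cases hg0 : g' = 0
    · rw [hg0, map_zero]
    by_cases hf0 : f' = 0
    · exact hL g' (Or.inl (Or.inr ⟨_, hmem, hf0, hg0, rfl⟩))
    by_cases hf1 : f' = 1
    · rw [hf1, Lin.ev_one] at hf
      exact absurd hf one_ne_zero
    by_cases hg1 : g' = 1
    · have := hL (f' + 1) (Or.inr ⟨_, hmem, hg1, hf1, rfl⟩)
      rw [Lin.ev_add_one_eq_zero, hf] at this
      exact absurd this zero_ne_one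
    by_cases hne : f' = g'
    · rw [← hne, hf]
    · exact hE f' g' ⟨hmem, hf0, hf1, hg0, hg1, hne⟩ hf
  · rintro ⟨hL, hE⟩
    have himp : ∀ e ∈ remainderPairs σ G, Lin.ev a e.1 = 0 → Lin.ev a e.2 = 0 := by
      rintro e ⟨f, g, hfg, hf, hg⟩ h
      rw [← hf.ev_eq hL] at h
      rw [← hg.ev_eq hL]
      exact hE f g hfg h
    refine ⟨?_, fun f g hfg hf => himp (f, g) hfg.1 hf⟩
    rintro l ((hl | ⟨e, he, h1, -, rfl⟩) | ⟨e, he, h2, -, rfl⟩)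
    · exact hL l hl
    · exact himp e he (by rw [h1, map_zero])
    · rw [Lin.ev_add_one_eq_zero]
      refine (zmod_two_eq_zero_or_one _).resolve_left fun h => ?_
      have := himp e he h
      rw [h2, Lin.ev_one] at this
      exact one_ne_zero this

/-- If a pass of `GGCP` finds something new, then this is not in the span. -/
theorem exists_notMem_span_of_ggcpPass {G : Tuple n} (hL : Interreduced σ G.L)
    (h : G.L ≠ (ggcpPass σ G).L) :
    ∃ f ∈ (ggcpPass σ G).L, f ∉ Submodule.span (ZMod 2) G.L := by
  have hsub : G.L ⊆ (ggcpPass σ G).L := fun l hl => Or.inl (Or.inl hl)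
  obtain ⟨f, hf, hfL⟩ := Set.exists_of_ssubset (hsub.ssubset_of_ne h)
  refine ⟨f, hf, ?_⟩
  rcases hf with (hf | ⟨e, ⟨_, _, -, -, hg⟩, -, h2, rfl⟩) | ⟨e, ⟨_, _, -, hf, hg⟩, h2, h1, rfl⟩
  · exact absurd hf hfL
  · exact hg.isNormal.notMem_span hL h2
  · have hn : IsNormal σ G.L (1 : Lin n) := h2 ▸ hg.isNormal
    exact (hf.isNormal.add hn).notMem_span hL fun h0 => h1 (Lin.add_eq_zero_iff.1 h0)

/-- Taking remainders commutes with adding `1` as soon as `1` is normal, and a kept edge guarantees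
this because its ends are nonzero and normal. -/
theorem Tuple.IsSkew.ggcpPass {G : Tuple n} (hG : G.IsSkew) (σ : MonomialOrder (Fin n)) :
    (ggcpPass σ G).IsClean where
  edge_mem f g hfg := ⟨⟨_, hfg, Or.inl rfl⟩, ⟨_, hfg, Or.inr rfl⟩⟩
  skew := by
    rintro f g ⟨⟨f₀, g₀, hE, hf, hg⟩, hf0, hf1, hg0, hg1, hne⟩
    have hn : IsNormal σ G.L (1 : Lin n) := hf.isNormal.one hf0
    have hnr : ∀ {p q : Lin n}, IsNR σ G.L p q → IsNR σ G.L (p + 1) (q + 1) := fun {p q} h =>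
      ⟨by rw [add_sub_add_right_eq_sub]; exact h.1, h.isNormal.add hn⟩
    refine ⟨⟨g₀ + 1, f₀ + 1, hG.skew _ _ hE, hnr hg, hnr hf⟩, ?_, ?_, ?_, ?_, ?_⟩
    · exact fun h => hg1 (Lin.add_eq_zero_iff.1 h)
    · exact fun h => hg0 (by simpa using h)
    · exact fun h => hf1 (Lin.add_eq_zero_iff.1 h)
    · exact fun h => hf0 (by simpa using h)
    · exact fun h => hne (add_right_cancel h).symm
  exists_edge := by
    rintro f ⟨e, he, rfl | rfl⟩
    · exact ⟨e.2, Or.inl he⟩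
    · exact ⟨e.1, Or.inr he⟩
  no_loop f hf := hf.2.2.2.2.2 rfl

/-- The properties of the result of `GGCP`: no vertex is constant modulo `L`, and distinct
vertices are distinct modulo `L`. -/
structure Tuple.IsPropagated (G : Tuple n) : Prop extends G.IsClean where
  notMem_span : ∀ f ∈ G.V, f ∉ Submodule.span (ZMod 2) G.L
  add_notMem_span : ∀ f ∈ G.V, ∀ g ∈ G.V, f ≠ g → f + g ∉ Submodule.span (ZMod 2) G.L

theorem isPropagated_ggcpPass {G : Tuple n} (hG : G.IsSkew) (hL : Interreduced σ G.L)
    (h : G.L = (ggcpPass σ G).L) : (ggcpPass σ G).IsPropagated := by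
  have hnormal : ∀ f ∈ (ggcpPass σ G).V, IsNormal σ G.L f ∧ f ≠ 0 := by
    rintro f ⟨e, ⟨⟨_, _, -, hf, hg⟩, hf0, -, hg0, -⟩, rfl | rfl⟩
    · exact ⟨hf.isNormal, hf0⟩
    · exact ⟨hg.isNormal, hg0⟩
  refine { hG.ggcpPass σ with notMem_span := fun f hf => ?_, add_notMem_span := ?_ }
  · rw [← h]
    exact (hnormal f hf).1.notMem_span hL (hnormal f hf).2
  · intro f hf g hg hne
    rw [← h]
    exact ((hnormal f hf).1.add (hnormal g hg).1).notMem_span hL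
      fun h0 => hne (Lin.add_eq_zero_iff.1 h0)

theorem Tuple.IsPropagated.add_one_notMem_span {G : Tuple n} (hG : G.IsPropagated) {f : Lin n}
    (hf : f ∈ G.V) : f + 1 ∉ Submodule.span (ZMod 2) G.L :=
  hG.notMem_span _ (hG.add_one_mem hf)

theorem Tuple.isPropagated_of_isEmpty {L : Set (Lin n)} :
    (⟨L, ∅, ∅⟩ : Tuple n).IsPropagated where
  edge_mem _ _ h := h.elim
  skew _ _ h := h.elim
  exists_edge _ h := h.elim
  no_loop _ h := h.elim
  notMem_span _ h := h.elim
  add_notMem_span _ h := h.elim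

theorem Tuple.acyclic_of_isEmpty {L V : Set (Lin n)} : (⟨L, V, ∅⟩ : Tuple n).Acyclic :=
  fun _ h => (Relation.TransGen.head'_iff.1 h).elim fun _ h => h.1.elim

theorem Tuple.zeros_univ {V : Set (Lin n)} {E : Set (Lin n × Lin n)} :
    (⟨Set.univ, V, E⟩ : Tuple n).zeros = ∅ :=
  Set.eq_empty_of_forall_notMem fun _ ha =>
    one_notMem_span ha (Submodule.subset_span (Set.mem_univ _))

/-- Each restart of `crGGCP` enlarges the span. -/
theorem Tuple.IsPropagated.exists_sccLinerals_notMem_span {G : Tuple n} (hG : G.IsPropagated)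
    {first : Set (Lin n) → Lin n} (hfirst : ∀ S ∈ G.sccs, first S ∈ S)
    (hne : sccLinerals G first ≠ ∅) :
    ∃ f ∈ sccLinerals G first, f ∉ Submodule.span (ZMod 2) G.L := by
  obtain ⟨h, hh⟩ := Set.nonempty_iff_ne_empty.2 hne
  refine ⟨h, hh, ?_⟩
  obtain ⟨S, hS, f, hf, hff, rfl⟩ := hh
  exact hG.add_notMem_span _ (hS.1.2.1 (hfirst S hS)) _ (hS.1.2.1 hf) hff.symm

theorem Tuple.IsSkew.zeros_adjoin_sccLinerals {G : Tuple n} (hG : G.IsSkew)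
    {first : Set (Lin n) → Lin n} (hfirst : ∀ S ∈ G.sccs, first S ∈ S) :
    (G.adjoin (sccLinerals G first)).zeros = G.zeros := by
  ext a
  rw [mem_zeros_adjoin, and_iff_left_iff_imp]
  rintro ha _ ⟨S, hS, f, hf, -, rfl⟩
  exact Lin.ev_add_eq_zero.2 (ev_eq_of_mem_scc hG ha hS (hfirst S hS) hf)

theorem Tuple.IsPropagated.exists_tFLS_notMem_span {G : Tuple n} (hG : G.IsPropagated)
    (hne : tFLS G ≠ ∅) :
    ∃ f ∈ (fun f => f + 1) '' tFLS G, f ∉ Submodule.span (ZMod 2) G.L := by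
  obtain ⟨f, hf⟩ := Set.nonempty_iff_ne_empty.2 hne
  refine ⟨f + 1, ⟨f, hf, rfl⟩, hG.add_one_notMem_span ?_⟩
  obtain ⟨p, ⟨hs, hp⟩, hanc, -⟩ := hf
  -- Ancestor sets contain their base point even if it is no vertex, so this has to be checked.
  have hpV : p.2 ∈ G.V := by
    rcases hp with ⟨h, -⟩ | ⟨h, -⟩
    · rw [h]
      exact hG.add_one_mem hs.1
    · exact h
  rcases hanc with rfl | ⟨h, -⟩
  · exact hpV
  · exact h

theorem Tuple.IsSkew.zeros_adjoin_tFLS {G : Tuple n} (hG : G.IsSkew) :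
    (G.adjoin ((fun f => f + 1) '' tFLS G)).zeros = G.zeros := by
  ext a
  rw [mem_zeros_adjoin, and_iff_left_iff_imp]
  rintro ha _ ⟨f, hf, rfl⟩
  exact Lin.ev_add_one_eq_zero.2 (ev_eq_one_of_mem_tFLS hG ha hf)

/-! ### Decisions -/

theorem Tuple.isDecision_iff {G : Tuple n} {L₀ L₁ : Set (Lin n)} :
    IsDecision G L₀ L₁ ↔ (∃ f ∈ L₀, f ∉ Submodule.span (ZMod 2) G.L) ∧
      (∃ f ∈ L₁, f ∉ Submodule.span (ZMod 2) G.L) ∧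
      ∀ a ∈ G.zeros, (∀ l ∈ L₀, Lin.ev a l = 0) ∨ ∀ l ∈ L₁, Lin.ev a l = 0 := by
  rw [IsDecision, zeroSet_ideal, zeroSet_ideal_sup, zeroSet_ideal_sup]
  refine and_congr_right fun _ => and_congr_right fun _ => forall_congr' fun a => ?_
  refine forall_congr' fun ha => ?_
  rw [Set.mem_union, mem_zeros_adjoin, mem_zeros_adjoin]
  simp [ha]

theorem Tuple.IsPath.ev_eq_zero {G : Tuple n} {a : Fin n → ZMod 2} (ha : a ∈ G.zeros)
    {f : Lin n} {l : List (Lin n)} (hl : (f :: l).IsChain fun f g => (f, g) ∈ G.E)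
    (hf : Lin.ev a f = 0) : ∀ g ∈ f :: l, Lin.ev a g = 0 := by
  induction l generalizing f with
  | nil => simpa using hf
  | cons g l ih =>
    rw [List.isChain_cons_cons] at hl
    have := ih hl.2 (ha.2 f g hl.1 hf)
    intro h hh
    rcases List.mem_cons.1 hh with rfl | hh
    · exact hf
    · exact this h hh

/-- By contraposition, the value `1` travels backwards along edges. -/
theorem Tuple.IsPath.ev_eq_one {G : Tuple n} {a : Fin n → ZMod 2} (ha : a ∈ G.zeros)
    {f : Lin n} {l : List (Lin n)} (hl : l.IsChain fun f g => (f, g) ∈ G.E)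
    (hlast : l.getLast? = some f) (hf : Lin.ev a f = 1) : ∀ g ∈ l, Lin.ev a g = 1 := by
  induction l with
  | nil => simp
  | cons g l ih =>
    cases l with
    | nil =>
      obtain rfl : g = f := by simpa using hlast
      simpa using hf
    | cons h l =>
      rw [List.isChain_cons_cons] at hl
      rw [List.getLast?_cons_cons] at hlast
      have := ih hl.2 hlast
      intro k hk
      rcases List.mem_cons.1 hk with rfl | hk
      · refine (zmod_two_eq_zero_or_one _).resolve_left fun h0 => ?_
        have h1 := this h List.mem_cons_self
        rw [ha.2 _ _ hl.1 h0] at h1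
        exact zero_ne_one h1
      · exact this k hk

theorem Tuple.IsPropagated.isDecision_of_produces {G : Tuple n} (hG : G.IsPropagated)
    (hE : G.E ≠ ∅) {m : DecisionMethod} {L₀ L₁ : Set (Lin n)} (h : m.Produces G L₀ L₁) :
    IsDecision G L₀ L₁ := by
  cases m with
  | maxReach =>
    obtain ⟨f, hf, -, rfl, rfl⟩ := h
    refine isDecision_iff.2 ⟨⟨f, Or.inl rfl, hG.notMem_span f hf.1⟩,
      ⟨f + 1, rfl, hG.add_one_notMem_span hf.1⟩, fun a ha => ?_⟩
    rcases zmod_two_eq_zero_or_one (Lin.ev a f) with h0 | h1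
    · exact Or.inl fun l hl => ev_eq_zero_of_mem_desc hG.toIsSkew ha hl h0
    · right
      rintro _ rfl
      exact Lin.ev_add_one_eq_zero.2 h1
  | maxBottleneck =>
    obtain ⟨f, hf, -, rfl, rfl⟩ := h
    refine isDecision_iff.2 ⟨⟨f, Or.inl rfl, hG.notMem_span f hf⟩,
      ⟨f + 1, Or.inl rfl, hG.add_one_notMem_span hf⟩, fun a ha => ?_⟩
    rcases zmod_two_eq_zero_or_one (Lin.ev a f) with h0 | h1
    · exact Or.inl fun l hl => ev_eq_zero_of_mem_desc hG.toIsSkew ha hl h0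
    · exact Or.inr fun l hl => ev_eq_zero_of_mem_desc hG.toIsSkew ha hl
        (Lin.ev_add_one_eq_zero.2 h1)
  | maxPath =>
    obtain ⟨l, f₁, fᵣ, hl, hmax, hhead, hlast, rfl, rfl⟩ := h
    obtain ⟨⟨u, v⟩, huv⟩ := Set.nonempty_iff_ne_empty.2 hE
    have huvV := hG.edge_mem u v huv
    -- Any edge is a path with two vertices, so a longest path has a second vertex, and the sum of
    -- its first two is outside the span.
    have hlen : 2 ≤ l.length := hmax [u, v] ⟨by simp, by simpa using huvV, by simpa using huv⟩
    obtain ⟨-, hV, hc⟩ := hl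
    match l, hlen with
    | [], hlen => simp at hlen
    | [_], hlen => simp at hlen
    | f :: g :: l, _ =>
      obtain rfl : f = f₁ := by simpa using hhead
      have hfg : G.Adj f g := (List.isChain_cons_cons.1 hc).1
      refine isDecision_iff.2 ⟨⟨f + g, ⟨g, by simp, rfl⟩, ?_⟩, ⟨f + 1, Or.inl rfl, ?_⟩,
        fun a ha => ?_⟩
      · exact hG.add_notMem_span f (hV f (by simp)) g (hV g (by simp))
          fun h => hG.no_loop f (by rw [← h] at hfg; exact hfg)
      · exact hG.add_one_notMem_span (hV f (by simp))
      -- Along a path the values are all `0` if the first is, and all `1` if the last is. The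
      -- remaining case, first `1` and last `0`, is the second branch.
      · rcases zmod_two_eq_zero_or_one (Lin.ev a f) with h0 | h1
        · left
          rintro _ ⟨k, hk, rfl⟩
          rw [Lin.ev_add_eq_zero, h0, IsPath.ev_eq_zero ha hc h0 k hk]
        · rcases zmod_two_eq_zero_or_one (Lin.ev a fᵣ) with hr | hr
          · right
            rintro _ (rfl | rfl)
            exacts [Lin.ev_add_one_eq_zero.2 h1, hr]
          · left
            rintro _ ⟨k, hk, rfl⟩
            rw [Lin.ev_add_eq_zero, h1, IsPath.ev_eq_one ha hc hlast hr k hk]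
  | other => exact h

/-- Every method to make a decision is applicable. -/
theorem Tuple.IsPropagated.exists_produces {G : Tuple n} (hG : G.IsPropagated)
    (hac : G.Acyclic) (hE : G.E ≠ ∅) (m : DecisionMethod) : ∃ L₀ L₁, m.Produces G L₀ L₁ := by
  obtain ⟨⟨u, v⟩, huv⟩ := Set.nonempty_iff_ne_empty.2 hE
  have huV := (hG.edge_mem u v huv).1
  cases m with
  | maxReach =>
    obtain ⟨f, hf, hmax⟩ := Set.exists_max_image G.sources G.pathsFrom (Set.toFinite _)
      (hac.exists_source ⟨u, huV⟩ hG.edge_mem)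
    exact ⟨_, _, f, hf, hmax, rfl, rfl⟩
  | maxBottleneck =>
    obtain ⟨f, hf, hmax⟩ := Set.exists_max_image G.V (fun g => G.pathsTo g + G.pathsFrom g)
      (Set.toFinite _) ⟨u, huV⟩
    exact ⟨_, _, f, hf, hmax, rfl, rfl⟩
  | maxPath =>
    obtain ⟨l, hl, hmax⟩ := hac.exists_longest_path ⟨u, huV⟩
    exact ⟨_, _, l, l.head hl.1, l.getLast hl.1, hl, hmax, List.head?_eq_some_head hl.1,
      List.getLast?_eq_some_getLast hl.1, rfl, rfl⟩
  | other =>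
    refine ⟨{u}, {u + 1}, isDecision_iff.2 ⟨⟨u, rfl, hG.notMem_span u huV⟩,
      ⟨u + 1, rfl, hG.add_one_notMem_span huV⟩, fun a _ => ?_⟩⟩
    rcases zmod_two_eq_zero_or_one (Lin.ev a u) with h0 | h1
    · left
      rintro _ rfl
      exact h0
    · right
      rintro _ rfl
      exact Lin.ev_add_one_eq_zero.2 h1

/-! ### Invariants of the solver -/

/-- The properties of the current tuple at the program points. -/
def Point.IsValid (σ : MonomialOrder (Fin n)) : Point n → Prop
  | .dpllStart G | .crStart G | .ggcpReduce G => G.IsSkew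
  | .ggcpLoop G => G.IsSkew ∧ Interreduced σ G.L
  | .crSCC G => G.IsPropagated
  | .dpllFL G | .dpllUnsat G => G.IsPropagated ∧ G.Acyclic
  | .dpllLinear G =>
    G.IsPropagated ∧ G.Acyclic ∧ (1 : Lin n) ∉ Submodule.span (ZMod 2) G.L
  | .dpllDecide _ G => G.IsPropagated ∧ G.Acyclic ∧ G.E ≠ ∅
  | .ret _ => True

/-- The zeros that belong to the active call. -/
def Point.zeros : Point n → Set (Fin n → ZMod 2)
  | .dpllStart G | .crStart G | .ggcpReduce G | .ggcpLoop G | .crSCC G | .dpllFL G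
  | .dpllUnsat G | .dpllLinear G | .dpllDecide _ G => G.zeros
  | .ret .unsat => ∅
  | .ret (.assignment a) => {a}

/-- The active call has returned an assignment. -/
def Point.IsSat : Point n → Prop
  | .ret (.assignment _) => True
  | _ => False

/-- Pending branches need only be skew, since each will begin with propagation. -/
def Config.IsValid (σ : MonomialOrder (Fin n)) (c : Config n) : Prop :=
  c.point.IsValid σ ∧ ∀ B ∈ c.stack, B.IsSkew

/-- The set `S` of solutions is covered by the active call and the pending branches, unless an
assignment was found. -/
structure Config.IsSound (S : Set (Fin n → ZMod 2)) (c : Config n) : Prop where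
  point_subset : c.point.zeros ⊆ S
  stack_subset : ∀ B ∈ c.stack, B.zeros ⊆ S
  cover : ¬ c.point.IsSat → ∀ a ∈ S, a ∈ c.point.zeros ∨ ∃ B ∈ c.stack, a ∈ B.zeros

/-- The number of linear polynomials outside of the span of `L`. -/
noncomputable def codegree (L : Set (Lin n)) : ℕ :=
  ((Submodule.span (ZMod 2) L : Set (Lin n))ᶜ).ncard

theorem codegree_lt {L L' : Set (Lin n)} (hsub : L ⊆ L')
    (h : ∃ f ∈ L', f ∉ Submodule.span (ZMod 2) L) : codegree L' < codegree L := by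
  obtain ⟨f, hf, hfL⟩ := h
  refine Set.ncard_lt_ncard ?_ (Set.toFinite _)
  have hle := Submodule.span_mono (R := ZMod 2) hsub
  exact (Set.ssubset_iff_of_subset (Set.compl_subset_compl.2 hle)).2
    ⟨f, hfL, fun h => h (Submodule.subset_span hf)⟩

/-- With base 3, two branches of smaller codegree use at most two thirds of the potential; the last
third pays for the additive constants. -/
theorem three_mul_pow_codegree_le {L L' : Set (Lin n)} (hsub : L ⊆ L')
    (h : ∃ f ∈ L', f ∉ Submodule.span (ZMod 2) L) : 3 * 3 ^ codegree L' ≤ 3 ^ codegree L := by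
  rw [← pow_succ']
  exact Nat.pow_le_pow_right (by norm_num) (codegree_lt hsub h)

/-- A bound for the number of steps of a call of the solver from a program point on. -/
noncomputable def Point.potential : Point n → ℕ
  | .dpllStart G => 20 * 3 ^ codegree G.L + 8
  | .crStart G => 20 * 3 ^ codegree G.L + 7
  | .ggcpReduce G => 20 * 3 ^ codegree G.L + 6
  | .ggcpLoop G => 20 * 3 ^ codegree G.L + 5
  | .crSCC G => 20 * 3 ^ codegree G.L + 4
  | .dpllFL G => 20 * 3 ^ codegree G.L + 3
  | .dpllUnsat G => 20 * 3 ^ codegree G.L + 2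
  | .dpllLinear G => 20 * 3 ^ codegree G.L + 1
  | .dpllDecide _ G => 20 * 3 ^ codegree G.L
  | .ret _ => 0

/-- A pending branch weighs one more than the call that it becomes, so that popping it is a strict
decrease. -/
noncomputable def Config.potential (c : Config n) : ℕ :=
  c.point.potential + (c.stack.map fun B => 20 * 3 ^ codegree B.L + 9).sum

/-! ### Effect of a single step on validity, potential and zeros -/

theorem Config.IsValid.step {c d : Config n} (hc : c.IsValid σ) (h : Step σ c d) :
    d.IsValid σ := by
  obtain ⟨hp, hK⟩ := hc
  cases h with
  | callCr G K => exact ⟨hp, hK⟩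
  | callGGCP G K => exact ⟨hp, hK⟩
  | ggcpInterreduce G K L' h => exact ⟨⟨⟨hp.edge_mem, hp.skew⟩, h.2⟩, hK⟩
  | ggcpAgain G K h => exact ⟨(hp.1.ggcpPass σ).toIsSkew, hK⟩
  | ggcpReturn G K h => exact ⟨isPropagated_ggcpPass hp.1 hp.2 h, hK⟩
  | crOdd G K h => exact ⟨⟨Tuple.isPropagated_of_isEmpty, Tuple.acyclic_of_isEmpty⟩, hK⟩
  | crAgain G K h first hfirst hne => exact ⟨hp.toIsSkew.adjoin _, hK⟩
  | crReturn G K h first hfirst he => exact ⟨⟨hp, hp.acyclic he⟩, hK⟩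
  | flAgain G K hne => exact ⟨hp.1.toIsSkew.adjoin _, hK⟩
  | flNone G K he => exact ⟨hp, hK⟩
  | retUnsat G K h => exact ⟨trivial, hK⟩
  | consistent G K h => exact ⟨⟨hp.1, hp.2, h⟩, hK⟩
  | retSolution G K h a ha => exact ⟨trivial, hK⟩
  | selectMethod G K h m => exact ⟨⟨hp.1, hp.2.1, h⟩, hK⟩
  | decide G K m L₀ L₁ h =>
    refine ⟨hp.1.toIsSkew.adjoin _, fun B hB => ?_⟩
    rcases List.mem_cons.1 hB with rfl | hB
    · exact hp.1.toIsSkew.adjoin _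
    · exact hK B hB
  | firstBranchSat a B K => exact ⟨trivial, fun C hC => hK C (List.mem_cons_of_mem _ hC)⟩
  | firstBranchUnsat B K =>
    exact ⟨hK B List.mem_cons_self, fun C hC => hK C (List.mem_cons_of_mem _ hC)⟩

theorem Config.IsValid.potential_lt {c d : Config n} (hc : c.IsValid σ) (h : Step σ c d) :
    d.potential < c.potential := by
  obtain ⟨hp, -⟩ := hc
  have hadj : ∀ (G : Tuple n) (M : Set (Lin n)), (∃ f ∈ M, f ∉ Submodule.span (ZMod 2) G.L) →
      3 * 3 ^ codegree (G.adjoin M).L ≤ 3 ^ codegree G.L := fun G M hM =>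
    three_mul_pow_codegree_le Set.subset_union_left
      (hM.imp fun f hf => ⟨Or.inr hf.1, hf.2⟩)
  cases h with
  | callCr G K => simp [potential, Point.potential]
  | callGGCP G K => simp [potential, Point.potential]
  | ggcpInterreduce G K L' h => simp [potential, Point.potential, codegree, h.1]
  | ggcpAgain G K h =>
    have := three_mul_pow_codegree_le (L' := (ggcpPass σ G).L)
      (fun l hl => Or.inl (Or.inl hl)) (exists_notMem_span_of_ggcpPass hp.2 h)
    have hpos : 0 < 3 ^ codegree (ggcpPass σ G).L := by positivity
    simp only [potential, Point.potential]
    omega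
  | ggcpReturn G K h =>
    simp only [potential, Point.potential, ← h]
    omega
  | crOdd G K h =>
    -- The span may already be everything; then the decrease comes from the additive constants
    -- alone.
    have h0 : codegree (Set.univ : Set (Lin n)) = 0 := by simp [codegree]
    have hpos : 0 < 3 ^ codegree G.L := by positivity
    simp only [potential, Point.potential, h0]
    omega
  | crAgain G K h first hfirst hne =>
    have := hadj G _ (hp.exists_sccLinerals_notMem_span hfirst hne)
    have hpos : 0 < 3 ^ codegree G.L := by positivity
    simp only [potential, Point.potential]
    omega
  | crReturn G K h first hfirst he => simp [potential, Point.potential]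
  | flAgain G K hne =>
    have := hadj G _ (hp.1.exists_tFLS_notMem_span hne)
    have hpos : 0 < 3 ^ codegree G.L := by positivity
    simp only [potential, Point.potential]
    omega
  | flNone G K he => simp [potential, Point.potential]
  | retUnsat G K h => simp [potential, Point.potential]
  | consistent G K h => simp [potential, Point.potential]
  | retSolution G K h a ha => simp [potential, Point.potential]
  | selectMethod G K h m => simp [potential, Point.potential]
  | decide G K m L₀ L₁ h =>
    have hd := hp.1.isDecision_of_produces hp.2.2 h
    have h0 := hadj G L₀ hd.1
    have h1 := hadj G L₁ hd.2.1
    -- The unused third of `20 * 3 ^ codegree G.L` is at least 20, more than the constants 8 and 9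
    -- of the two branches together.
    have hpos : 0 < 3 ^ codegree (G.adjoin L₀).L := by positivity
    simp only [potential, Point.potential, List.map_cons, List.sum_cons]
    omega
  | firstBranchSat a B K => simp [potential, Point.potential]
  | firstBranchUnsat B K =>
    simp only [potential, Point.potential, List.map_cons, List.sum_cons]
    omega

/-- All steps that neither branch nor return an assignment nor pop the stack are instances of this.
-/
theorem Config.IsSound.of_zeros_eq {S : Set (Fin n → ZMod 2)} {p q : Point n}
    {K : List (Tuple n)} (h : Config.IsSound S ⟨p, K⟩) (hp : ¬ p.IsSat)
    (heq : q.zeros = p.zeros) : Config.IsSound S ⟨q, K⟩ where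
  point_subset := heq.subset.trans h.point_subset
  stack_subset := h.stack_subset
  cover _ a ha := (h.cover hp a ha).imp_left fun h => heq.symm.subset h

theorem Config.IsSound.step {S : Set (Fin n → ZMod 2)} {c d : Config n} (hs : c.IsSound S)
    (hc : c.IsValid σ) (h : Step σ c d) : d.IsSound S := by
  obtain ⟨hp, -⟩ := hc
  cases h with
  | callCr G K => exact hs.of_zeros_eq id rfl
  | callGGCP G K => exact hs.of_zeros_eq id rfl
  | ggcpInterreduce G K L' h => exact hs.of_zeros_eq id (Tuple.zeros_of_span_eq h.1)
  | ggcpAgain G K h => exact hs.of_zeros_eq id (zeros_ggcpPass σ G)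
  | ggcpReturn G K h => exact hs.of_zeros_eq id (zeros_ggcpPass σ G)
  | crOdd G K h =>
    exact hs.of_zeros_eq id (Tuple.zeros_univ.trans (hp.zeros_eq_empty_of_odd h).symm)
  | crAgain G K h first hfirst hne =>
    exact hs.of_zeros_eq id (hp.toIsSkew.zeros_adjoin_sccLinerals hfirst)
  | crReturn G K h first hfirst he => exact hs.of_zeros_eq id rfl
  | flAgain G K hne => exact hs.of_zeros_eq id hp.1.toIsSkew.zeros_adjoin_tFLS
  | flNone G K he => exact hs.of_zeros_eq id rfl
  | retUnsat G K h =>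
    refine hs.of_zeros_eq id (Set.eq_empty_of_forall_notMem fun a ha => ?_).symm
    exact Tuple.one_notMem_span ha h
  | consistent G K h => exact hs.of_zeros_eq id rfl
  | retSolution G K h a ha =>
    refine ⟨?_, hs.stack_subset, fun h => absurd trivial h⟩
    rintro _ rfl
    refine hs.point_subset ⟨mem_linZeroSet.1 ha, fun f g hfg => ?_⟩
    rw [Tuple.Adj, h] at hfg
    exact hfg.elim
  | selectMethod G K h m => exact hs.of_zeros_eq id rfl
  | decide G K m L₀ L₁ h =>
    have hd := (Tuple.isDecision_iff.1 (hp.1.isDecision_of_produces hp.2.2 h)).2.2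
    have hsub : ∀ M, (G.adjoin M).zeros ⊆ S := fun M a ha =>
      hs.point_subset (Tuple.mem_zeros_adjoin.1 ha).1
    refine ⟨hsub L₀, fun B hB => ?_, fun _ a ha => ?_⟩
    · rcases List.mem_cons.1 hB with rfl | hB
      · exact hsub L₁
      · exact hs.stack_subset B hB
    · rcases hs.cover id a ha with haG | ⟨B, hB, haB⟩
      · rcases hd a haG with h0 | h1
        · exact Or.inl (Tuple.mem_zeros_adjoin.2 ⟨haG, h0⟩)
        · exact Or.inr ⟨_, List.mem_cons_self, Tuple.mem_zeros_adjoin.2 ⟨haG, h1⟩⟩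
      · exact Or.inr ⟨B, List.mem_cons_of_mem _ hB, haB⟩
  | firstBranchSat a B K =>
    exact ⟨hs.point_subset, fun C hC => hs.stack_subset C (List.mem_cons_of_mem _ hC),
      fun h => absurd trivial h⟩
  | firstBranchUnsat B K =>
    refine ⟨hs.stack_subset B List.mem_cons_self,
      fun C hC => hs.stack_subset C (List.mem_cons_of_mem _ hC), fun _ a ha => ?_⟩
    rcases hs.cover id a ha with h | ⟨C, hC, haC⟩
    · exact h.elim
    · rcases List.mem_cons.1 hC with rfl | hC
      · exact Or.inl haC
      · exact Or.inr ⟨C, hC, haC⟩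

/-- The solver can be continued until it returns a result. -/
theorem Config.IsValid.exists_step {c : Config n} (hc : c.IsValid σ)
    (hret : ∀ r, c ≠ ⟨.ret r, []⟩) : ∃ d, Step σ c d := by
  obtain ⟨p, K⟩ := c
  obtain ⟨hp, -⟩ := hc
  cases p with
  | dpllStart G => exact ⟨_, .callCr G K⟩
  | crStart G => exact ⟨_, .callGGCP G K⟩
  | ggcpReduce G =>
    obtain ⟨L', hL'⟩ := exists_isInterreduction σ G.L
    exact ⟨_, .ggcpInterreduce G K L' hL'⟩
  | ggcpLoop G =>
    by_cases h : G.L = (ggcpPass σ G).L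
    · exact ⟨_, .ggcpReturn G K h⟩
    · exact ⟨_, .ggcpAgain G K h⟩
  | crSCC G =>
    by_cases h : Odd G.sccs.ncard
    · exact ⟨_, .crOdd G K h⟩
    · have hex : ∀ S : Set (Lin n), ∃ f, S ∈ G.sccs → f ∈ S := fun S => by
        by_cases hS : S ∈ G.sccs
        · exact hS.1.1.imp fun f hf _ => hf
        · exact ⟨0, fun h' => absurd h' hS⟩
      choose first hfirst using hex
      by_cases he : sccLinerals G first = ∅
      · exact ⟨_, .crReturn G K h first hfirst he⟩
      · exact ⟨_, .crAgain G K h first hfirst he⟩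
  | dpllFL G =>
    by_cases h : tFLS G = ∅
    · exact ⟨_, .flNone G K h⟩
    · exact ⟨_, .flAgain G K h⟩
  | dpllUnsat G =>
    by_cases h : (1 : Lin n) ∈ Submodule.span (ZMod 2) G.L
    · exact ⟨_, .retUnsat G K h⟩
    · exact ⟨_, .consistent G K h⟩
  | dpllLinear G =>
    by_cases h : G.E = ∅
    · obtain ⟨a, ha⟩ := linZeroSet_nonempty hp.2.2
      exact ⟨_, .retSolution G K h a ha⟩
    · exact ⟨_, .selectMethod G K h .other⟩
  | dpllDecide m G =>
    obtain ⟨L₀, L₁, h⟩ := hp.1.exists_produces hp.2.1 hp.2.2 m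
    exact ⟨_, .decide G K m L₀ L₁ h⟩
  | ret r =>
    cases K with
    | nil => exact absurd rfl (hret r)
    | cons B K =>
      cases r with
      | unsat => exact ⟨_, .firstBranchUnsat B K⟩
      | assignment a => exact ⟨_, .firstBranchSat a B K⟩

/-! ### From single steps to whole runs -/

theorem Config.IsValid.reflTransGen {c d : Config n} (hc : c.IsValid σ)
    (h : Relation.ReflTransGen (Step σ) c d) : d.IsValid σ := by
  induction h with
  | refl => exact hc
  | tail _ h ih => exact ih.step h

theorem Config.IsSound.reflTransGen {S : Set (Fin n → ZMod 2)} {c d : Config n}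
    (hs : c.IsSound S) (hc : c.IsValid σ) (h : Relation.ReflTransGen (Step σ) c d) :
    d.IsSound S := by
  induction h with
  | refl => exact hs
  | tail h' h ih => exact ih.step (hc.reflTransGen h') h

theorem start_isValid {G : Tuple n} (hG : G.IsSkew) : (start G).IsValid σ :=
  ⟨hG, fun _ h => absurd h List.not_mem_nil⟩

theorem start_isSound (G : Tuple n) : (start G).IsSound G.zeros :=
  ⟨subset_rfl, fun _ h => absurd h List.not_mem_nil, fun _ _ ha => Or.inl ha⟩

theorem Tuple.IsSkew.terminates {G : Tuple n} (hG : G.IsSkew) (σ : MonomialOrder (Fin n)) :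
    Terminates σ G := by
  refine ⟨?_, fun c hc hstuck => ?_⟩
  · rintro ⟨c, h0, hstep⟩
    have hvalid : ∀ i, (c i).IsValid σ := fun i => by
      induction i with
      | zero => rw [h0]; exact start_isValid hG
      | succ i ih => exact ih.step (hstep i)
    have hbound : ∀ i, (c i).potential + i ≤ (c 0).potential := fun i => by
      induction i with
      | zero => exact le_rfl
      | succ i ih =>
        have := (hvalid i).potential_lt (hstep i)
        omega
    have := hbound ((c 0).potential + 1)
    omega
  · by_contra hret
    obtain ⟨d, hd⟩ := ((start_isValid hG).reflTransGen hc).exists_step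
      fun r hr => hret ⟨r, hr⟩
    exact hstuck d hd

theorem IsIGS.zeros_eq {F : XNF n} {G : Tuple n} (h : IsIGS F G) : G.zeros = F.sat := by
  rw [← G.zeroSet_ideal]
  exact (zeroSet_eq_sat_iff F G.ideal).2 h.algRep_eq.symm

end TwoXNF

theorem proposition4p14 {n : ℕ} (σ : MonomialOrder (Fin n)) (F : TwoXNF.XNF n)
    (hF : F.IsKXNF 2) (G : TwoXNF.Tuple n) (hG : TwoXNF.IsIGS F G) :
    TwoXNF.Terminates σ G ∧
    ∀ r, TwoXNF.Returns σ G r →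
      (r = TwoXNF.Result.unsat ↔ F.sat = ∅) ∧
      (F.sat ≠ ∅ → ∃ a ∈ F.sat, r = TwoXNF.Result.assignment a) := by
  refine ⟨hG.isSkew.terminates σ, fun r hr => ?_⟩
  have hs := (TwoXNF.start_isSound G).reflTransGen (TwoXNF.start_isValid hG.isSkew) hr
  rw [hG.zeros_eq] at hs
  cases r with
  | unsat =>
    have hempty : F.sat = ∅ := Set.eq_empty_of_forall_notMem fun a ha =>
      (hs.cover id a ha).elim id fun ⟨_, hB, _⟩ => absurd hB List.not_mem_nil
    exact ⟨⟨fun _ => hempty, fun _ => rfl⟩, fun h => absurd hempty h⟩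
  | assignment a =>
    have ha : a ∈ F.sat := hs.point_subset rfl
    exact ⟨⟨fun h => (nomatch h), fun h => absurd ha (by rw [h]; exact id)⟩, fun _ => ⟨a, ha, rfl⟩⟩
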